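/- Let $k$ be a finite field with algebraic closure $\bar k$, let $G$ be an algebraic group over $k$ (a group scheme of finite type over $k$), and let $X$ be a $k$-scheme with a left action of $G$. For a $k$-scheme $S$, let $[G\backslash X](S)$ be the category of pairs $(T,f)$, where $T$ is a (left, fppf) $G$-torsor over $S$ and $f\colon T\to X_S$ is a $G_S$-equivariant morphism over $S$; its morphisms $(T,f)\to(T',f')$ are the $G_S$-equivariant morphisms $\varphi\colon T\to T'$ over $S$ with $f'\circ\varphi=f$, and objects are pulled back along morphisms $S'\to S$ of $k$-schemes by base change. Let $C\in G(\bar k)\backslash X(\bar k)$ be an orbit, and let $P(C)$ be the corresponding isomorphism class in $[G\backslash X](\bar k)$, that is, the class of $(G_{\bar k},\, g\mapsto g\cdot x)$ for any $x\in C$. Then for every finite extension $k\subset k'\subset\bar k$ the following are equivalent: 1. $P(C)$ admits a model over $k'$, i.e. there is an object $(\tilde T,\tilde f)$ of $[G\backslash X](k')$ whose base change $(\tilde T,\tilde f)_{\bar k}$ lies in the isomorphism class $P(C)$; 2. $C$ is fixed under the natural action of $\mathrm{Gal}(\bar k/k')$ on $G(\bar k)\backslash X(\bar k)$. -/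

import Mathlib

open CategoryTheory AlgebraicGeometry Limits MonoidalCategory CartesianMonoidalCategory

open scoped MonObj

universe u v w

noncomputable section

namespace QuotStack

section Categorical

/-! ### Actions of group objects -/

variable {C : Type w} [Category.{v} C] [CartesianMonoidalCategory C]

/-- An action of a monoid object may be given by a morphism that satisfies the axioms of an action
on generalized points. -/
abbrev actionOfPoints {G T : C} [MonObj G] (a : G ⊗ T ⟶ T)
    (h_one : ∀ {Z : C} (t : Z ⟶ T), lift (1 : Z ⟶ G) t ≫ a = t)
    (h_mul : ∀ {Z : C} (g h : Z ⟶ G) (t : Z ⟶ T),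
      lift (g * h) t ≫ a = lift g (lift h t ≫ a) ≫ a) : ModObj G T where
  smul := a
  one_smul := by
    change η[G] ▷ T ≫ a = (λ_ T).hom
    have h := h_one (snd (𝟙_ C) T)
    rw [leftUnitor_hom, ← h]
    congr 1
    ext
    · simp only [whiskerRight_fst, lift_fst, Hom.one_def]
      congr 1
      exact toUnit_unique _ _
    · simp
  mul_smul := by
    change μ[G] ▷ T ≫ a = (α_ G G T).hom ≫ G ◁ a ≫ a
    have h := h_mul (fst (G ⊗ G) T ≫ fst G G) (fst (G ⊗ G) T ≫ snd G G) (snd (G ⊗ G) T)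
    convert h using 1
    · congr 1
      ext
      · simp [Hom.mul_def, ← comp_lift]
      · simp
    · rw [← Category.assoc]
      congr 1
      ext
      · simp
      · simp only [Category.assoc, whiskerLeft_snd, lift_snd]
        rw [← Category.assoc]
        congr 1
        ext <;> simp

/-- `G` acts on `G × S` by left multiplication on the first factor. -/
abbrev translationAction (G S : C) [MonObj G] : ModObj G (G ⊗ S) :=
  actionOfPoints (lift (fst G (G ⊗ S) * (snd G (G ⊗ S) ≫ fst G S)) (snd G (G ⊗ S) ≫ snd G S))
    (fun t ↦ by ext <;> simp [comp_lift, MonObj.comp_mul])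
    (fun g h t ↦ by ext <;> simp [comp_lift, MonObj.comp_mul, mul_assoc])

variable {G : C} [MonObj G]

/-- If `π : T ⟶ S` is invariant under `G`, then `G` acts on `T ×_S S'` through `T`. -/
abbrev pullbackAction {T S S' : C} [ModObj G T] (π : T ⟶ S) (s : S' ⟶ S) [HasPullback π s]
    (h : γ[G, T] ≫ π = snd G T ≫ π) : ModObj G (pullback π s) :=
  actionOfPoints
    (pullback.lift (fst G (pullback π s) • (snd G (pullback π s) ≫ pullback.fst π s))
      (snd G (pullback π s) ≫ pullback.snd π s)
      (by simp [Hom.smul_def, h, pullback.condition]))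
    (fun t ↦ by
      apply pullback.hom_ext
      · simp only [Category.assoc, pullback.lift_fst, ModObj.comp_smul, lift_fst, lift_snd_assoc,
          one_smul]
      · simp only [Category.assoc, pullback.lift_snd, lift_snd_assoc])
    (fun g h t ↦ by
      apply pullback.hom_ext
      · simp only [Category.assoc, pullback.lift_fst, ModObj.comp_smul, lift_fst, lift_snd_assoc,
          mul_smul]
      · simp only [Category.assoc, pullback.lift_snd, lift_snd_assoc])

/-- The square with sides `(g, t) ↦ g • t` and `(g, t) ↦ t` over `S` is cartesian iff `π` is
invariant and `G` acts simply transitively on the generalized points of its fibres. -/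
theorem isPullback_iff {T S : C} [ModObj G T] (π : T ⟶ S) :
    IsPullback γ[G, T] (snd G T) π π ↔ γ[G, T] ≫ π = snd G T ≫ π ∧
      ∀ {Z : C} (a b : Z ⟶ T), a ≫ π = b ≫ π → ∃! g : Z ⟶ G, g • b = a := by
  constructor
  · intro h
    refine ⟨h.w, fun {Z} a b hab ↦ ⟨h.lift a b hab ≫ fst G T, ?_, ?_⟩⟩
    · have : lift (h.lift a b hab ≫ fst G T) b = h.lift a b hab := by
        ext
        · simp
        · simp
      change lift _ _ ≫ _ = _
      rw [this]
      simp
    · intro g hg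
      have : lift g b = h.lift a b hab := by
        apply h.hom_ext
        · simpa [Hom.smul_def] using hg
        · simp
      rw [← this]
      simp
  · rintro ⟨hw, h⟩
    refine ⟨⟨hw⟩, ⟨PullbackCone.IsLimit.mk hw (fun s ↦ lift (h s.fst s.snd s.condition).choose s.snd)
      ?_ ?_ ?_⟩⟩
    · intro s
      exact (h s.fst s.snd s.condition).choose_spec.1
    · intro s
      simp
    · intro s m h₁ h₂
      apply CartesianMonoidalCategory.hom_ext (X := G) (Y := T)
      · rw [lift_fst]
        apply (h s.fst s.snd s.condition).choose_spec.2
        rw [← h₁, ← h₂, Hom.smul_def]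
        congr 1
        ext <;> simp
      · simpa using h₂


/-- Equivariance may be checked on generalized points. -/
theorem isModHom_of_points {T T' : C} [ModObj G T] [ModObj G T'] (f : T ⟶ T')
    (h : ∀ {Z : C} (g : Z ⟶ G) (t : Z ⟶ T), (g • t) ≫ f = g • (t ≫ f)) : IsModHom G f where
  smul_hom := by
    change γ[G, T] ≫ f = G ◁ f ≫ γ[G, T']
    have h' := h (fst G T) (snd G T)
    simp only [Hom.smul_def, lift_fst_snd, Category.id_comp] at h'
    rw [h']
    congr 1
    ext <;> simp

/-- Right translation by a point `g : S ⟶ G` is equivariant for left translations. -/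
theorem isModHom_translation {S : C} (g : S ⟶ G) :
    letI := translationAction G S
    IsModHom G (lift (fst G S * (snd G S ≫ g)) (snd G S)) := by
  let := translationAction G S
  refine isModHom_of_points _ fun {Z} h t ↦ ?_
  change (lift h t ≫ lift _ _) ≫ _ = lift h (t ≫ _) ≫ lift _ _
  ext <;> simp [MonObj.comp_mul, mul_assoc]

end Categorical

/-! ### Quotient stacks -/

section Stack

variable {k : Type u} [Field k]

/-- A `G`-torsor over a `k`-scheme `S`: a scheme `T` over `S` with a left action of `G` over `S`
such that `T → S` is flat, surjective and locally of finite presentation, and such that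
`G ×ₖ T → T ×_S T`, `(g, t) ↦ (g t, t)` is an isomorphism. The last condition is that the square
formed by the action, the projection and twice `π : T → S` is cartesian; in particular
`π (g t) = π t`, so that the action is one over `S`. -/
structure IsTorsor (G : Over (Spec (.of k))) [GrpObj G] {T S : Over (Spec (.of k))} [ModObj G T]
    (π : T ⟶ S) : Prop where
  flat : Flat π.left
  surjective : Surjective π.left
  locallyOfFinitePresentation : LocallyOfFinitePresentation π.left
  isPullback : IsPullback γ[G, T] (snd G T) π π

/-- An object over the `k`-scheme `S` of the quotient stack `[G \ X]`: a `G`-torsor `π : T → S`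
with a `G`-equivariant morphism `f : T → X` over `k`, which is the same thing as a
`G_S`-equivariant morphism `T → X_S = X ×ₖ S` over `S`. -/
structure QuotientStack (G X : Over (Spec (.of k))) [GrpObj G] [ModObj G X]
    (S : Over (Spec (.of k))) where
  /-- the total space of the torsor -/
  T : Over (Spec (.of k))
  /-- the action of `G` on the total space -/
  [action : ModObj G T]
  /-- the structure morphism of the torsor -/
  π : T ⟶ S
  torsor : IsTorsor G π
  /-- the equivariant morphism to `X` -/
  f : T ⟶ X
  [equivariant : IsModHom G f]

namespace QuotientStack

attribute [instance] action equivariant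

variable {G X : Over (Spec (.of k))} [GrpObj G] [ModObj G X] {S S' : Over (Spec (.of k))}

/-- Morphisms in the fibre of `[G \ X]` over `S`: equivariant morphisms over `S` of the torsors
that are compatible with the morphisms to `X`. -/
@[ext]
structure Hom (A B : QuotientStack G X S) where
  /-- the underlying morphism of schemes -/
  hom : A.T ⟶ B.T
  equivariant : IsModHom G hom
  hom_π : hom ≫ B.π = A.π
  hom_f : hom ≫ B.f = A.f

instance : Category (QuotientStack G X S) where
  Hom := Hom
  id A := ⟨𝟙 A.T, inferInstance, Category.id_comp _, Category.id_comp _⟩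
  comp φ ψ := ⟨φ.hom ≫ ψ.hom,
    have := φ.equivariant
    have := ψ.equivariant
    inferInstance,
    by rw [Category.assoc, ψ.hom_π, φ.hom_π], by rw [Category.assoc, ψ.hom_f, φ.hom_f]⟩
  id_comp _ := Hom.ext (Category.id_comp _)
  comp_id _ := Hom.ext (Category.comp_id _)
  assoc _ _ _ := Hom.ext (Category.assoc _ _ _)

/-- The set of isomorphism classes of the fibre of `[G \ X]` over `S`. -/
abbrev IsoClasses (G X : Over (Spec (.of k))) [GrpObj G] [ModObj G X]
    (S : Over (Spec (.of k))) : Type (u + 1) :=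
  Quotient (isIsomorphicSetoid (QuotientStack G X S))

/-- The pullback of `(T, f)` along `s : S' → S`: the torsor `T ×_S S'` over `S'` and the composite
of its projection to `T` with `f`. -/
def baseChange (A : QuotientStack G X S) (s : S' ⟶ S) : QuotientStack G X S' :=
  letI : ModObj G (pullback A.π s) := pullbackAction A.π s A.torsor.isPullback.w
  have smul_fst {Z : Over (Spec (.of k))} (g : Z ⟶ G) (t : Z ⟶ pullback A.π s) :
      (g • t) ≫ pullback.fst A.π s = g • (t ≫ pullback.fst A.π s) := by
    change (lift g t ≫ pullback.lift _ _ _) ≫ _ = _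
    simp only [Category.assoc, pullback.lift_fst, ModObj.comp_smul, lift_fst, lift_snd_assoc]
  have smul_snd {Z : Over (Spec (.of k))} (g : Z ⟶ G) (t : Z ⟶ pullback A.π s) :
      (g • t) ≫ pullback.snd A.π s = t ≫ pullback.snd A.π s := by
    change (lift g t ≫ pullback.lift _ _ _) ≫ _ = _
    simp only [Category.assoc, pullback.lift_snd, lift_snd_assoc]
  have sq : IsPullback (pullback.fst A.π s).left (pullback.snd A.π s).left A.π.left s.left :=
    (IsPullback.of_hasPullback A.π s).map (Over.forget _)
  have h_fst : IsModHom G (pullback.fst A.π s) := isModHom_of_points _ smul_fst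
  { T := pullback A.π s
    π := pullback.snd A.π s
    torsor :=
      { flat := MorphismProperty.of_isPullback (P := @Flat) sq A.torsor.flat
        surjective := MorphismProperty.of_isPullback (P := @Surjective) sq A.torsor.surjective
        locallyOfFinitePresentation := MorphismProperty.of_isPullback
          (P := @LocallyOfFinitePresentation) sq A.torsor.locallyOfFinitePresentation
        isPullback := by
          refine (isPullback_iff _).mpr ⟨?_, fun {Z} a b hab ↦ ?_⟩
          · have h := smul_snd (fst G (pullback A.π s)) (snd G (pullback A.π s))
            simpa only [Hom.smul_def, lift_fst_snd, Category.id_comp] using h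
          · obtain ⟨g, hg, hu⟩ := ((isPullback_iff _).mp A.torsor.isPullback).2
              (a ≫ pullback.fst A.π s) (b ≫ pullback.fst A.π s) (by
                rw [Category.assoc, Category.assoc, pullback.condition, reassoc_of% hab])
            refine ⟨g, ?_, fun g' hg' ↦ hu g' ?_⟩
            · apply pullback.hom_ext
              · rw [smul_fst, hg]
              · rw [smul_snd, hab]
            · change g' • (b ≫ _) = _
              rw [← smul_fst, hg'] }
    f := pullback.fst A.π s ≫ A.f
    equivariant := inferInstance }

/-- For a point `x ∈ X(S)`, the object of `[G \ X]` over `S` given by the trivial torsor `G_S` and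
the orbit map `g ↦ g x`. -/
def ofPoint [LocallyOfFiniteType G.hom] (x : S ⟶ X) : QuotientStack G X S :=
  letI : ModObj G (G ⊗ S) := translationAction G S
  have smul_fst {Z : Over (Spec (.of k))} (g : Z ⟶ G) (t : Z ⟶ G ⊗ S) :
      (g • t) ≫ fst G S = g * (t ≫ fst G S) := by
    change (lift g t ≫ lift _ _) ≫ _ = _
    simp [MonObj.comp_mul]
  have smul_snd {Z : Over (Spec (.of k))} (g : Z ⟶ G) (t : Z ⟶ G ⊗ S) :
      (g • t) ≫ snd G S = t ≫ snd G S := by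
    change (lift g t ≫ lift _ _) ≫ _ = _
    simp
  { T := G ⊗ S
    π := snd G S
    torsor :=
      { flat := by
          change Flat (pullback.snd G.hom S.hom)
          infer_instance
        surjective := by
          change Surjective (pullback.snd G.hom S.hom)
          have : Nonempty G.left := ⟨η[G].left (IsLocalRing.closedPoint k)⟩
          have : Surjective G.hom :=
            ⟨Function.surjective_to_subsingleton (α := G.left) (β := Spec (.of k)) _⟩
          infer_instance
        locallyOfFinitePresentation := by
          change LocallyOfFinitePresentation (pullback.snd G.hom S.hom)
          infer_instance
        isPullback := by
          refine (isPullback_iff _).mpr ⟨?_, fun {Z} a b hab ↦ ?_⟩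
          · have h := smul_snd (fst G (G ⊗ S)) (snd G (G ⊗ S))
            simpa only [Hom.smul_def, lift_fst_snd, Category.id_comp] using h
          · refine ⟨(a ≫ fst G S) * (b ≫ fst G S)⁻¹, ?_, fun g hg ↦ ?_⟩
            · apply CartesianMonoidalCategory.hom_ext
              · rw [smul_fst, inv_mul_cancel_right]
              · rw [smul_snd, hab]
            · rw [← hg, smul_fst, mul_inv_cancel_right] }
    f := fst G S • (snd G S ≫ x)
    equivariant := isModHom_of_points _ fun g t ↦ by
      rw [ModObj.comp_smul, ModObj.comp_smul, smul_fst, ← Category.assoc, smul_snd, mul_smul,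
        Category.assoc] }

/-- Right translation by `g` identifies the objects given by the points `g x` and `x`. -/
def ofPointIso [LocallyOfFiniteType G.hom] (g : S ⟶ G) (x : S ⟶ X) :
    ofPoint (G := G) (g • x) ≅ ofPoint (G := G) x where
  hom :=
    { hom := lift (fst G S * (snd G S ≫ g)) (snd G S)
      equivariant := isModHom_translation g
      hom_π := lift_snd _ _
      hom_f := by
        change lift _ _ ≫ (fst G S • (snd G S ≫ x)) = fst G S • (snd G S ≫ (g • x))
        rw [ModObj.comp_smul, ModObj.comp_smul, lift_fst, lift_snd_assoc, mul_smul] }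
  inv :=
    { hom := lift (fst G S * (snd G S ≫ g⁻¹)) (snd G S)
      equivariant := isModHom_translation g⁻¹
      hom_π := lift_snd _ _
      hom_f := by
        change lift _ _ ≫ (fst G S • (snd G S ≫ (g • x))) = fst G S • (snd G S ≫ x)
        rw [ModObj.comp_smul, lift_fst, lift_snd_assoc, ModObj.comp_smul,
          ← mul_smul, mul_assoc, ← MonObj.comp_mul, inv_mul_cancel, MonObj.comp_one, mul_one] }
  hom_inv_id := by
    apply Hom.ext
    change lift (fst G S * (snd G S ≫ g)) (snd G S) ≫
      lift (fst G S * (snd G S ≫ g⁻¹)) (snd G S) = 𝟙 (G ⊗ S)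
    ext1
    · simp only [Category.assoc, lift_fst, lift_snd_assoc, MonObj.comp_mul, mul_assoc,
        Category.id_comp]
      rw [← MonObj.comp_mul, mul_inv_cancel, MonObj.comp_one, mul_one]
    · simp
  inv_hom_id := by
    apply Hom.ext
    change lift (fst G S * (snd G S ≫ g⁻¹)) (snd G S) ≫
      lift (fst G S * (snd G S ≫ g)) (snd G S) = 𝟙 (G ⊗ S)
    ext1
    · simp only [Category.assoc, lift_fst, lift_snd_assoc, MonObj.comp_mul, mul_assoc,
        Category.id_comp]
      rw [← MonObj.comp_mul, inv_mul_cancel, MonObj.comp_one, mul_one]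
    · simp

end QuotientStack

/-! ### Geometric orbits and models -/

variable (k) in
/-- `Spec A` as a `k`-scheme. -/
abbrev specOver (A : Type u) [CommRing A] [Algebra k A] : Over (Spec (.of k)) :=
  Over.mk (Spec.map (CommRingCat.ofHom (algebraMap k A)))

/-- The morphism `Spec B → Spec A` over `k` of a homomorphism of `k`-algebras `A → B`. -/
def specMap {A B : Type u} [CommRing A] [CommRing B] [Algebra k A] [Algebra k B]
    (φ : A →ₐ[k] B) : specOver k B ⟶ specOver k A :=
  Over.homMk (Spec.map (CommRingCat.ofHom φ.toRingHom)) (by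
    change Spec.map _ ≫ Spec.map _ = Spec.map _
    rw [← Spec.map_comp, ← CommRingCat.ofHom_comp, AlgHom.toRingHom_eq_coe, AlgHom.comp_algebraMap])

theorem specMap_id (A : Type u) [CommRing A] [Algebra k A] :
    specMap (AlgHom.id k A) = 𝟙 (specOver k A) := by
  ext1
  exact Spec.map_id _

theorem specMap_comp {A B D : Type u} [CommRing A] [CommRing B] [CommRing D] [Algebra k A]
    [Algebra k B] [Algebra k D] (φ : A →ₐ[k] B) (ψ : B →ₐ[k] D) :
    specMap (ψ.comp φ) = specMap ψ ≫ specMap φ := by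
  ext1
  exact Spec.map_comp (CommRingCat.ofHom φ.toRingHom) (CommRingCat.ofHom ψ.toRingHom)

variable (G X : Over (Spec (.of k))) [GrpObj G] [ModObj G X]
variable (L : Type u) [Field L] [Algebra k L]

/-- The set `G(L) \ X(L)` of orbits of `G(L)` on `X(L)`. -/
def Orbits : Type u :=
  MulAction.orbitRel.Quotient (specOver k L ⟶ G) (specOver k L ⟶ X)

/-- The Galois group acts on `X(L)` by `σ x = x ∘ Spec σ`, and thereby on `G(L) \ X(L)`. -/
instance : MulAction Gal(L/k) (Orbits G X L) where
  smul σ := Quotient.map (fun x ↦ specMap (σ : L →ₐ[k] L) ≫ x) (by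
    rintro _ y ⟨g, rfl⟩
    exact ⟨specMap (σ : L →ₐ[k] L) ≫ g, (ModObj.comp_smul _ _ _).symm⟩)
  one_smul C := by
    induction C using Quotient.inductionOn with
    | h x =>
      refine congrArg (Quotient.mk _) ?_
      change specMap (AlgHom.id k L) ≫ x = x
      rw [specMap_id, Category.id_comp]
  mul_smul σ τ C := by
    induction C using Quotient.inductionOn with
    | h x =>
      refine congrArg (Quotient.mk _) ?_
      change specMap ((σ : L →ₐ[k] L).comp (τ : L →ₐ[k] L)) ≫ x = _
      rw [specMap_comp, Category.assoc]

variable {G X L}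

/-- The isomorphism class `P(C)` in `[G \ X](L)` that corresponds to an orbit `C` of `G(L)` on
`X(L)`: the class of the trivial torsor with the orbit map `g ↦ g x`, for any `x ∈ C`. -/
def P [LocallyOfFiniteType G.hom] (C : Orbits G X L) :
    QuotientStack.IsoClasses G X (specOver k L) :=
  Quotient.lift
    (fun x : specOver k L ⟶ X ↦ Quotient.mk (isIsomorphicSetoid _) (QuotientStack.ofPoint (G := G) x))
    (by
      rintro _ y ⟨g, rfl⟩
      exact Quotient.sound ⟨QuotientStack.ofPointIso g y⟩) C

/-- An isomorphism class in `[G \ X](L)` has a model over the subextension `k'` of `L/k` if it is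
the class of the base change to `L` of an object of `[G \ X](k')`. -/
def HasModel (k' : Type u) [Field k'] [Algebra k k'] [Algebra k' L] [IsScalarTower k k' L]
    (c : QuotientStack.IsoClasses G X (specOver k L)) : Prop :=
  ∃ M : QuotientStack G X (specOver k k'),
    Quotient.mk (isIsomorphicSetoid _) (M.baseChange (specMap (IsScalarTower.toAlgHom k k' L))) = c

end Stack

end QuotStack

end

/-!
Suppose that `C` is the orbit of `x` and let `F` be the Frobenius over `k'`.

If an object `(T, f)` over `k'` becomes isomorphic to `(G, g ↦ g x)` over `k̄`, then `x = f t` for a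
point `t` of `T` over `k̄`. Every `σ` in the Galois group of `k'` preserves the fibre of `T` that
contains `t`, so `σ t = g t` and `σ x = g x` for some `g ∈ G(k̄)`.

Conversely, stability of `C` under `F` already gives `g ∈ G(k̄)` with `F x = g x`. The products
`F^{i-1}(g) ⋯ F(g) g` have finitely many values, so for all `N` divisible by some `n` the `N`-th one
is trivial and `F^N x = x`. Hence `x` and `g` are defined over some finite `K / k'` of degree `N`
divisible by `n`, and `φ(a, t) = (a g(t)⁻¹, F t)` is an `F`-semilinear automorphism of `G_K` with
`φ^N = 1` that is compatible with the action of `G` and the orbit map of `x`. The quotient of `G_K`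
by `φ` is the torsor over `k'`, and the action and the orbit map descend to it along `K / k'`.

The quotient exists if the `φ`-stable affine opens cover `G_K`. They contain the intersections of
the finitely many opens `φ^{-i}(h⁻¹ U)`, where `U` is a dense affine open of `G` and `h ∈ G(K)`.
A closed point has a finite `φ`-orbit, all of which some `h` moves into `U`, and as `G` is
quasi-compact, finitely many `h` are enough, so that they can be taken over a common `K`.
-/

noncomputable section

namespace QuotStack

/-! ### Cyclic Galois descent -/

section CyclicDescent

open Module TensorProduct

variable {k K : Type*} [Field k] [Field K] [Algebra k K]

/-- The matrix `(F ^ i (b j))` of the conjugates of a basis `b` of `K / k` under the powers of `F`;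
it is invertible when these powers exhaust the Galois group. -/
def conjugateMatrix {n : ℕ} (F : K →ₐ[k] K) (b : Basis (Fin n) k K) : Matrix (Fin n) (Fin n) K :=
  .of fun i j ↦ (F ^ (i : ℕ)) (b j)

theorem isUnit_det_conjugateMatrix {n : ℕ} {F : K →ₐ[k] K} (hF : orderOf F = n)
    (b : Basis (Fin n) k K) : IsUnit (conjugateMatrix F b).det := by
  rw [← Matrix.isUnit_iff_isUnit_det, ← Matrix.linearIndependent_rows_iff_isUnit]
  have linearIndependent_pow := (linearIndependent_algHom_toLinearMap k K K).comp
    (fun i : Fin n ↦ F ^ (i : ℕ)) fun i j hij ↦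
      Fin.ext (pow_injOn_Iio_orderOf (by simp [hF]) (by simp [hF]) hij)
  exact linearIndependent_pow.map' (b.constr K).symm.toLinearMap (LinearEquiv.ker _)

section Semilinear

variable {V : Type*} [AddCommGroup V] [Module K V] {F : K →ₐ[k] K}
  {φ : V →ₛₗ[(F : K →+* K)] V}

theorem iterate_smul (n : ℕ) (c : K) (x : V) : φ^[n] (c • x) = (F ^ n) c • φ^[n] x := by
  induction n generalizing c x with
  | zero => simp
  | succ n ih =>
    rw [Function.iterate_succ_apply, map_smulₛₗ, ih, pow_succ, Function.iterate_succ_apply]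
    rfl

theorem iterate_sum {I : Type*} (s : Finset I) (n : ℕ) (f : I → V) :
    φ^[n] (∑ i ∈ s, f i) = ∑ i ∈ s, φ^[n] (f i) := by
  induction n with
  | zero => rfl
  | succ n ih => simp only [Function.iterate_succ_apply', ih, map_sum]

theorem map_sum_iterate_eq {n : ℕ} (hφ : φ^[n] = id) (x : V) :
    φ (∑ i ∈ Finset.range n, φ^[i] x) = ∑ i ∈ Finset.range n, φ^[i] x := by
  have h := Finset.sum_range_succ (fun i ↦ φ^[i] x) n
  rw [Finset.sum_range_succ', hφ] at h
  simp_rw [map_sum, ← Function.iterate_succ_apply' φ]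
  simpa using h

theorem span_fixedPoints_eq_top [FiniteDimensional k K] (hF : orderOf F = finrank k K)
    (hφ : φ^[finrank k K] = id) : Submodule.span K {x | φ x = x} = ⊤ := by
  let b := finBasis k K
  let M := conjugateMatrix F b
  have hM : M * M⁻¹ = 1 := M.mul_nonsing_inv (isUnit_det_conjugateMatrix hF b)
  let zero : Fin (finrank k K) := ⟨0, finrank_pos⟩
  refine eq_top_iff.mpr fun x _ ↦ ?_
  have trace_eq (c : K) : ∑ i ∈ Finset.range (finrank k K), φ^[i] (c • x) =
      ∑ i : Fin (finrank k K), (F ^ (i : ℕ)) c • φ^[i] x := by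
    simp_rw [Finset.sum_range, iterate_smul]
  have x_eq : x = ∑ j, M⁻¹ j zero • ∑ i ∈ Finset.range (finrank k K), φ^[i] (b j • x) := by
    calc x = ∑ i, (M * M⁻¹) i zero • φ^[i] x := by simp [hM, Matrix.one_apply, zero]
      _ = ∑ j, M⁻¹ j zero • ∑ i : Fin (finrank k K), (F ^ (i : ℕ)) (b j) • φ^[i] x := by
        simp_rw [Matrix.mul_apply, Finset.sum_smul, Finset.smul_sum, smul_smul]
        rw [Finset.sum_comm]
        simp [M, conjugateMatrix, mul_comm]
      _ = _ := by simp_rw [trace_eq]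
  rw [x_eq]
  exact Submodule.sum_mem _ fun j _ ↦ Submodule.smul_mem _ _
    (Submodule.subset_span (map_sum_iterate_eq hφ _))

theorem eq_zero_of_sum_basis_smul_eq_zero {n : ℕ} (hF : orderOf F = n) (b : Basis (Fin n) k K)
    {y : Fin n → V} (hy : ∀ i, φ (y i) = y i) (h : ∑ i, b i • y i = 0) : y = 0 := by
  let M := conjugateMatrix F b
  have hM : M⁻¹ * M = 1 := M.nonsing_inv_mul (isUnit_det_conjugateMatrix hF b)
  have conjugate (j : Fin n) : ∑ i, M j i • y i = 0 := by
    have iterate_zero : φ^[j] 0 = 0 := Function.iterate_fixed (map_zero φ) j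
    rw [← iterate_zero, ← h, iterate_sum]
    refine Finset.sum_congr rfl fun i _ ↦ ?_
    rw [iterate_smul, Function.iterate_fixed (hy i)]
    rfl
  ext l
  calc y l = ∑ i, (M⁻¹ * M) l i • y i := by simp [hM, Matrix.one_apply]
    _ = ∑ j, M⁻¹ l j • ∑ i, M j i • y i := by
      simp_rw [Matrix.mul_apply, Finset.sum_smul, Finset.smul_sum, smul_smul]
      exact Finset.sum_comm
    _ = 0 := by simp [conjugate]

theorem isBaseChange_fixedPoints [Module k V] [IsScalarTower k K V] [FiniteDimensional k K]
    {B : Submodule k V} (hF : orderOf F = finrank k K) (hφ : φ^[finrank k K] = id)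
    (hB : ∀ x, x ∈ B ↔ φ x = x) : IsBaseChange K B.subtype := by
  let m : K ⊗[k] B →ₗ[K] V := B.subtype.liftBaseChange K
  have injective : Function.Injective m := by
    rw [injective_iff_map_eq_zero]
    intro z hz
    obtain ⟨y, rfl⟩ := eq_repr_basis_left (finBasis k K) z
    rw [y.sum_fintype _ (by simp)] at hz ⊢
    have hy := eq_zero_of_sum_basis_smul_eq_zero hF (finBasis k K)
      (y := fun i ↦ (y i : V)) (fun i ↦ (hB _).mp (y i).2) (by simpa [m] using hz)
    exact Finset.sum_eq_zero fun i _ ↦ by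
      rw [show y i = 0 from Subtype.ext (congrFun hy i), tmul_zero]
  have surjective : Function.Surjective m := by
    rw [← LinearMap.range_eq_top, LinearMap.range_liftBaseChange, LinearMap.coe_range,
      Submodule.coe_subtype, Subtype.range_coe,
      show (B : Set V) = {x | φ x = x} from Set.ext hB]
    exact span_fixedPoints_eq_top hF hφ
  exact .of_equiv (.ofBijective m ⟨injective, surjective⟩) fun x ↦ by
    change m (1 ⊗ₜ x) = x
    simp [m]

end Semilinear

/-- `K ⊗ K → ∏ K`, `a ⊗ b ↦ (a * F ^ i b)_i`, where `i` runs through `Fin n`. -/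
def tensorToPi (F : K →ₐ[k] K) (n : ℕ) : K ⊗[k] K →ₐ[k] (Fin n → K) :=
  AlgHom.pi fun i ↦
    Algebra.TensorProduct.lift (AlgHom.id k K) (F ^ (i : ℕ)) fun _ _ ↦ Commute.all _ _

theorem tensorToPi_tmul (F : K →ₐ[k] K) (n : ℕ) (a b : K) (i : Fin n) :
    tensorToPi F n (a ⊗ₜ b) i = a * (F ^ (i : ℕ)) b := rfl

theorem bijective_tensorToPi [FiniteDimensional k K] {F : K →ₐ[k] K}
    (hF : orderOf F = finrank k K) : Function.Bijective (tensorToPi F (finrank k K)) := by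
  let b := finBasis k K
  let M := conjugateMatrix F b
  have hM : M * M⁻¹ = 1 := M.mul_nonsing_inv (isUnit_det_conjugateMatrix hF b)
  have surjective : Function.Surjective (tensorToPi F (finrank k K)) := fun x ↦ by
    refine ⟨∑ j, (M⁻¹).mulVec x j ⊗ₜ b j, ?_⟩
    calc tensorToPi F (finrank k K) (∑ j, (M⁻¹).mulVec x j ⊗ₜ b j) = M.mulVec (M⁻¹.mulVec x) := by
          ext i
          simp only [map_sum, Finset.sum_apply, tensorToPi_tmul]
          exact Finset.sum_congr rfl fun j _ ↦ mul_comm _ _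
      _ = x := by rw [Matrix.mulVec_mulVec, hM, Matrix.one_mulVec]
  have finrank_eq : finrank k (K ⊗[k] K) = finrank k (Fin (finrank k K) → K) := by
    simp [finrank_tensorProduct, finrank_pi_fintype]
  exact ⟨(LinearMap.injective_iff_surjective_of_finrank_eq_finrank
    (f := (tensorToPi F (finrank k K)).toLinearMap) finrank_eq).mpr surjective, surjective⟩

end CyclicDescent

section EndomorphismPowers

variable {C : Type*} [Category* C] {X Y : C}

theorem pow_comp_eq_comp_pow {φ : End X} {ψ : End Y} {f : X ⟶ Y} (h : φ ≫ f = f ≫ ψ) (n : ℕ) :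
    (φ ^ n : End X) ≫ f = f ≫ (ψ ^ n : End Y) := by
  induction n with
  | zero => exact (Category.id_comp f).trans (Category.comp_id f).symm
  | succ n ih =>
    rw [pow_succ, pow_succ, End.mul_def, End.mul_def, Category.assoc, ih, reassoc_of% h]

theorem pow_comp_eq_self {φ : End X} {f : X ⟶ Y} (h : φ ≫ f = f) (n : ℕ) :
    (φ ^ n : End X) ≫ f = f := by
  rw [pow_comp_eq_comp_pow (ψ := 1) (h.trans (Category.comp_id f).symm), one_pow]
  exact Category.comp_id f

theorem Spec_map_pow {R : CommRingCat.{u}} (f : R →+* R) (n : ℕ) :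
    Spec.map (CommRingCat.ofHom (f ^ n)) =
      (End.of (Spec.map (CommRingCat.ofHom f)) ^ n : End _) := by
  induction n with
  | zero => exact Spec.map_id R
  | succ n ih =>
    rw [pow_succ', pow_succ, End.mul_def, ← ih, ← Spec.map_comp]
    rfl

end EndomorphismPowers

section FieldExtension

open Module

variable {k K : Type u} [Field k] [Field K] [Algebra k K]

theorem specMap_pow {A : Type u} [CommRing A] [Algebra k A] (F : A →ₐ[k] A) (n : ℕ) :
    specMap (F ^ n) = (End.of (specMap F) ^ n : End (specOver k A)) := by
  induction n with
  | zero => exact specMap_id A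
  | succ n ih => rw [pow_succ', pow_succ, End.mul_def, ← ih, ← specMap_comp]; rfl

/-- The structure morphism of the ring of invariants of a semilinear ring endomorphism. -/
def toInvariants {R : Type*} [CommRing R] {F : K →ₐ[k] K} {i : K →+* R} {φ : R →+* R}
    (hφ : φ.comp i = i.comp F) : k →+* φ.eqLocus (RingHom.id R) :=
  (i.comp (algebraMap k K)).codRestrict _ fun c ↦ by
    have h := RingHom.congr_fun hφ (algebraMap k K c)
    simpa [RingHom.eqLocus] using h

theorem isPullback_Spec_invariants [FiniteDimensional k K] {F : K →ₐ[k] K}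
    (hF : orderOf F = finrank k K) {R : Type u} [CommRing R] {i : K →+* R} {φ : R →+* R}
    (hφ : φ.comp i = i.comp F) (h_pow : φ ^ finrank k K = 1) :
    IsPullback (Spec.map (CommRingCat.ofHom (φ.eqLocus (RingHom.id R)).subtype))
      (Spec.map (CommRingCat.ofHom i)) (Spec.map (CommRingCat.ofHom (toInvariants hφ)))
      (specOver k K).hom := by
  let := i.toAlgebra
  let := (i.comp (algebraMap k K)).toAlgebra
  have : IsScalarTower k K R := .of_algebraMap_eq fun _ ↦ rfl
  let invariants : Subalgebra k R :=
    { φ.eqLocus (RingHom.id R) with algebraMap_mem' := fun c ↦ (toInvariants hφ c).2 }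
  let semilinear : R →ₛₗ[(F : K →+* K)] R :=
    { toFun := φ
      map_add' := map_add φ
      map_smul' := fun c x ↦ by
        rw [Algebra.smul_def, Algebra.smul_def, map_mul]
        exact congrArg (· * _) (RingHom.congr_fun hφ c) }
  have iterate_eq : semilinear^[finrank k K] = id := by
    change φ^[finrank k K] = id
    rw [← RingHom.coe_pow, h_pow]
    rfl
  have : Algebra.IsPushout k K invariants R := by
    rw [Algebra.isPushout_iff]
    exact isBaseChange_fixedPoints (φ := semilinear) (B := invariants.toSubmodule) hF iterate_eq
      fun _ ↦ Iff.rfl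
  exact isPullback_SpecMap_of_isPushout _ _ _ _
    (CommRingCat.isPushout_of_isPushout k K invariants R).flip

theorem exists_openCover_pullback_specOver [FiniteDimensional k K] {F : K →ₐ[k] K}
    (hF : orderOf F = finrank k K) :
    ∃ 𝒰 : Scheme.OpenCover.{u} (pullback (specOver k K).hom (specOver k K).hom),
      ∀ j : 𝒰.I₀, ∃ n : ℕ, 𝒰.f j ≫ pullback.snd _ _ =
        𝒰.f j ≫ pullback.fst _ _ ≫ (specMap (F ^ n)).left := by
  let e : TensorProduct k K K →ₐ[k] (ULift.{u} (Fin (finrank k K)) → K) :=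
    (AlgEquiv.piCongrLeft k (fun _ ↦ K) Equiv.ulift.symm).toAlgHom.comp (tensorToPi F _)
  have : IsIso (CommRingCat.ofHom e.toRingHom) := by
    refine (ConcreteCategory.isIso_iff_bijective _).mpr ?_
    exact (AlgEquiv.piCongrLeft k (fun _ ↦ K) Equiv.ulift.symm).bijective.comp
      (bijective_tensorToPi hF)
  let R : ULift.{u} (Fin (finrank k K)) → CommRingCat := fun _ ↦ .of K
  let α : (∐ fun i ↦ Spec (R i)) ⟶ _ :=
    sigmaSpec R ≫ Spec.map (CommRingCat.ofHom e.toRingHom) ≫ (pullbackSpecIso k K K).inv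
  have : IsIso α := IsIso.comp_isIso' inferInstance (IsIso.comp_isIso' inferInstance inferInstance)
  have ι_comp (j) : Sigma.ι (fun i ↦ Spec (R i)) j ≫ α =
      Spec.map (CommRingCat.ofHom ((Pi.evalRingHom (fun _ ↦ K) j).comp e.toRingHom)) ≫
        (pullbackSpecIso k K K).inv := by
    simp only [α]
    rw [ι_sigmaSpec_assoc, ← Spec.map_comp_assoc]
    rfl
  have comp_snd (j : ULift.{u} (Fin (finrank k K))) :
      (Sigma.ι (fun i ↦ Spec (R i)) j ≫ α) ≫ pullback.snd _ _ =
        (Sigma.ι (fun i ↦ Spec (R i)) j ≫ α) ≫ pullback.fst _ _ ≫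
          Spec.map (CommRingCat.ofHom (F ^ (j.down : ℕ)).toRingHom) := by
    rw [ι_comp, Category.assoc, Category.assoc, pullbackSpecIso_inv_snd,
      pullbackSpecIso_inv_fst_assoc, ← Spec.map_comp, ← Spec.map_comp, ← Spec.map_comp]
    congr 1
    ext c
    change tensorToPi F _ (1 ⊗ₜ c) j.down = tensorToPi F _ ((F ^ (j.down : ℕ)) c ⊗ₜ 1) j.down
    rw [tensorToPi_tmul, tensorToPi_tmul, map_one, one_mul, mul_one]
  exact ⟨(sigmaOpenCover fun i ↦ Spec (R i)).pushforwardIso α, fun j ↦ ⟨_, comp_snd j⟩⟩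

variable {Z Z' W : Scheme.{u}} {q : Z' ⟶ Z} {r : Z' ⟶ Spec (.of K)} {z : Z ⟶ Spec (.of k)}

theorem surjective_flat_quasiCompact_of_isPullback (h : IsPullback q r z (specOver k K).hom) :
    (@Surjective ⊓ @Flat ⊓ @QuasiCompact : MorphismProperty Scheme) q := by
  have : Surjective (specOver k K).hom :=
    ⟨Function.surjective_to_subsingleton (α := Spec (.of K)) (β := Spec (.of k)) _⟩
  have : Flat (specOver k K).hom := inferInstanceAs (Flat (Spec.map _))
  exact ⟨⟨MorphismProperty.of_isPullback (P := @Surjective) h.flip inferInstance,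
    MorphismProperty.of_isPullback (P := @Flat) h.flip inferInstance⟩,
    MorphismProperty.of_isPullback (P := @QuasiCompact) h.flip
      (inferInstanceAs (QuasiCompact (Spec.map _)))⟩

theorem exists_comp_eq_of_comp_eq_self [FiniteDimensional k K] {F : K →ₐ[k] K}
    (hF : orderOf F = finrank k K) (h : IsPullback q r z (specOver k K).hom)
    {φ : End Z'} (hq : φ ≫ q = q) (hr : φ ≫ r = r ≫ (specMap F).left) {f : Z' ⟶ W}
    (hf : φ ≫ f = f) : ∃ f' : Z ⟶ W, q ≫ f' = f := by
  obtain ⟨⟨_, _⟩, _⟩ := surjective_flat_quasiCompact_of_isPullback h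
  have pow_comp_r (n : ℕ) : (φ ^ n : End Z') ≫ r = r ≫ (specMap (F ^ n)).left := by
    rw [pow_comp_eq_comp_pow hr, specMap_pow]
    exact congrArg (r ≫ ·)
      (map_pow ((Over.forget _).mapEnd (specOver k K)) (End.of (specMap F)) n).symm
  obtain ⟨𝒰, h𝒰⟩ := exists_openCover_pullback_specOver hF
  let c : pullback q q ⟶ pullback (specOver k K).hom (specOver k K).hom :=
    pullback.map _ _ _ _ r r z h.w h.w
  have fst_comp : pullback.fst q q ≫ r = c ≫ pullback.fst _ _ := by simp only [c, pullback.lift_fst]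
  have snd_comp : pullback.snd q q ≫ r = c ≫ pullback.snd _ _ := by simp only [c, pullback.lift_snd]
  refine IsRegularEpi.exists_of_isKernelPair q (IsPullback.of_hasPullback q q) f ?_
  refine Scheme.Cover.hom_ext (𝒰.pullback₁ c) _ _ fun j ↦ ?_
  change pullback.fst c (𝒰.f j) ≫ _ = pullback.fst c (𝒰.f j) ≫ _
  obtain ⟨n, hn⟩ := h𝒰 j
  have snd_eq : pullback.fst c (𝒰.f j) ≫ pullback.snd q q =
      pullback.fst c (𝒰.f j) ≫ pullback.fst q q ≫ (φ ^ n : End Z') := by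
    apply h.hom_ext
    · simp only [Category.assoc, pow_comp_eq_self hq, pullback.condition]
    · simp only [Category.assoc, pow_comp_r, snd_comp, reassoc_of% fst_comp,
        pullback.condition_assoc, hn]
  rw [reassoc_of% snd_eq, pow_comp_eq_self hf]

end FieldExtension

/-! ### Quotients by a semilinear automorphism -/

section Gluing

variable {J : Type*} [Category* J] {A B : J ⥤ Scheme.{u}} {q : A ⟶ B}

theorem isLocallyDirected_of_equifibered_of_surjective (hq : q.Equifibered)
    (h_surj : ∀ i, Surjective (q.app i)) [(A ⋙ Scheme.forget).IsLocallyDirected] :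
    (B ⋙ Scheme.forget).IsLocallyDirected where
  cond {i j k} fi fj xi xj h := by
    obtain ⟨y, hy⟩ := (h_surj k).surj (B.map fi xi)
    obtain ⟨a, hay, rfl⟩ := Scheme.exists_preimage_of_isPullback (hq fi) y xi hy
    obtain ⟨b, hby, rfl⟩ := Scheme.exists_preimage_of_isPullback (hq fj) y xj (hy.trans h)
    obtain ⟨l, gi, gj, c, rfl, rfl⟩ :=
      (A ⋙ Scheme.forget).exists_map_eq_of_isLocallyDirected fi fj a b (hay.trans hby.symm)
    exact ⟨l, gi, gj, q.app l c, congr($(q.naturality gi) c).symm, congr($(q.naturality gj) c).symm⟩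

variable [Quiver.IsThin J] [Small.{u} J]
  [∀ {i j} (f : i ⟶ j), IsOpenImmersion (A.map f)] [(A ⋙ Scheme.forget).IsLocallyDirected]
  [∀ {i j} (f : i ⟶ j), IsOpenImmersion (B.map f)] [(B ⋙ Scheme.forget).IsLocallyDirected]

theorem isPullback_colimMap_of_equifibered (hq : q.Equifibered) (i : J) :
    IsPullback (colimit.ι A i) (q.app i) (colimMap q) (colimit.ι B i) := by
  refine (IsOpenImmersion.isPullback _ _ _ _ (ι_colimMap q i) ?_).flip
  ext y
  constructor
  · rintro ⟨b, hb⟩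
    obtain ⟨j, a, rfl⟩ := Scheme.IsLocallyDirected.ι_jointly_surjective A y
    rw [← Scheme.Hom.comp_apply, ι_colimMap, Scheme.Hom.comp_apply] at hb
    obtain ⟨l, fi, fj, x, -, hx⟩ := (Scheme.IsLocallyDirected.ι_eq_ι_iff B).mp hb
    obtain ⟨w, rfl, -⟩ := Scheme.exists_preimage_of_isPullback (hq fj) a x hx.symm
    refine ⟨A.map fi w, ?_⟩
    rw [← Scheme.Hom.comp_apply, ← Scheme.Hom.comp_apply, colimit.w, colimit.w]
  · rintro ⟨a, rfl⟩
    exact ⟨q.app i a, congr($(ι_colimMap q i) a).symm⟩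

theorem isPullback_map_of_equifibered (hq : q.Equifibered) {c : Cocone A} (hc : IsColimit c)
    (i : J) :
    IsPullback (c.ι.app i) (q.app i) (hc.map (colimit.cocone B) q) (colimit.ι B i) := by
  let e : colimit A ≅ c.pt := (colimit.isColimit A).coconePointUniqueUpToIso hc
  refine (isPullback_colimMap_of_equifibered hq i).of_iso (Iso.refl _) e (Iso.refl _) (Iso.refl _)
    ?_ ?_ ?_ ?_
  · simp [e]
  · simp
  · refine colimit.hom_ext fun j ↦ ?_
    simp [e]
  · simp

theorem isPullback_of_openCover_of_isPullback {Y T S E : Scheme.{u}} {p : Y ⟶ T} {r : Y ⟶ E}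
    {π : T ⟶ S} {e : E ⟶ S} (𝒱 : T.OpenCover) {X : 𝒱.I₀ → Scheme.{u}} {c : ∀ i, X i ⟶ Y}
    {q : ∀ i, X i ⟶ 𝒱.X i} (hp : ∀ i, IsPullback (c i) (q i) p (𝒱.f i))
    (hπ : ∀ i, IsPullback (q i) (c i ≫ r) (𝒱.f i ≫ π) e) : IsPullback p r π e := by
  refine Scheme.isPullback_of_openCover _ _ _ _ 𝒱 fun i ↦ ?_
  refine (hπ i).of_iso (hp i).isoPullback (Iso.refl _) (Iso.refl _) (Iso.refl _) ?_ ?_ ?_ ?_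
  · exact (Category.comp_id _).trans (hp i).isoPullback_hom_snd.symm
  · exact (Category.comp_id _).trans
      (congr($((hp i).isoPullback_hom_fst.symm) ≫ r).trans (Category.assoc _ _ _))
  · simp
  · simp

end Gluing

section Quotient

open Module

variable {Y : Scheme.{u}} (φ : Y ⟶ Y)

/-- The affine open subschemes that are stable under an endomorphism. -/
abbrev StableAffineOpens : Type u := {V : Y.Opens // IsAffineOpen V ∧ φ ⁻¹ᵁ V = V}

namespace StableAffineOpens

/-- The diagram of the stable affine opens. -/
abbrev spectra : StableAffineOpens φ ⥤ Scheme.{u} where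
  obj V := Spec Γ(Y, V.1)
  map f := Spec.map (Y.presheaf.map (homOfLE f.le).op)
  map_id V := by
    change Spec.map (Y.presheaf.map (𝟙 _)) = _
    rw [CategoryTheory.Functor.map_id, Spec.map_id]
  map_comp f g := by
    rw [← Spec.map_comp, ← Functor.map_comp]
    rfl

variable {φ} (V : StableAffineOpens φ)

/-- The endomorphism of the ring of functions on a stable affine open. -/
def ringEnd : Γ(Y, V.1) →+* Γ(Y, V.1) := (φ.appLE V.1 V.1 V.2.2.ge).hom

/-- The invariant functions on a stable affine open. -/
abbrev invariants : Subring Γ(Y, V.1) := V.ringEnd.eqLocus (RingHom.id _)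

theorem map_mem_invariants {V W : StableAffineOpens φ} (h : V ≤ W) (a : W.invariants) :
    Y.presheaf.map (homOfLE h).op a.1 ∈ V.invariants := by
  have naturality : φ.appLE W.1 W.1 W.2.2.ge ≫ Y.presheaf.map (homOfLE h).op =
      Y.presheaf.map (homOfLE h).op ≫ φ.appLE V.1 V.1 V.2.2.ge := by
    rw [Scheme.Hom.appLE_map, Scheme.Hom.map_appLE]
  calc φ.appLE V.1 V.1 V.2.2.ge (Y.presheaf.map (homOfLE h).op a.1)
      = Y.presheaf.map (homOfLE h).op (φ.appLE W.1 W.1 W.2.2.ge a.1) := congr($naturality a.1).symm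
    _ = Y.presheaf.map (homOfLE h).op a.1 := congrArg _ a.2

/-- The restriction of invariant functions. -/
def restrictInvariants {V W : StableAffineOpens φ} (h : V ≤ W) : W.invariants →+* V.invariants :=
  ((Y.presheaf.map (homOfLE h).op).hom.comp W.invariants.subtype).codRestrict _
    (map_mem_invariants h)

variable (φ) in
/-- The diagram of the quotients of the stable affine opens, that is, of the spectra of the rings
of invariant functions. -/
abbrev quotients : StableAffineOpens φ ⥤ Scheme.{u} where
  obj V := Spec (.of V.invariants)
  map f := Spec.map (CommRingCat.ofHom (restrictInvariants f.le))
  map_id V := by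
    have restrict_refl : restrictInvariants (le_refl V) = RingHom.id _ := by
      ext a
      change Y.presheaf.map (𝟙 _) a.1 = a.1
      simp
    exact (congrArg (fun f ↦ Spec.map (CommRingCat.ofHom f)) restrict_refl).trans (Spec.map_id _)
  map_comp {U V W} f g := by
    rw [← Spec.map_comp, ← CommRingCat.ofHom_comp]
    congr 2
    ext a
    change Y.presheaf.map _ a.1 = Y.presheaf.map _ (Y.presheaf.map _ a.1)
    rw [← ConcreteCategory.comp_apply, ← Functor.map_comp]
    rfl

variable (φ) in
/-- The quotient maps of the stable affine opens. -/
def quotientMap : spectra φ ⟶ quotients φ where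
  app V := Spec.map (CommRingCat.ofHom V.invariants.subtype)
  naturality V W f := by
    rw [← Spec.map_comp, ← Spec.map_comp]
    rfl

/-- The inclusion of a stable affine open. -/
def chart : (spectra φ).obj V ⟶ Y := V.2.1.fromSpec

instance : IsOpenImmersion V.chart := inferInstanceAs (IsOpenImmersion V.2.1.fromSpec)

theorem opensRange_chart : V.chart.opensRange = V.1 := V.2.1.opensRange_fromSpec

theorem map_chart {V W : StableAffineOpens φ} (f : V ⟶ W) : (spectra φ).map f ≫ W.chart = V.chart :=
  W.2.1.map_fromSpec V.2.1 _

instance isOpenImmersion_spectra_map {V W : StableAffineOpens φ} (f : V ⟶ W) :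
    IsOpenImmersion ((spectra φ).map f) := by
  have : IsOpenImmersion ((spectra φ).map f ≫ W.chart) := by rw [map_chart]; infer_instance
  exact IsOpenImmersion.of_comp _ W.chart

/-- The restriction of the endomorphism to a stable affine open. -/
def specEnd : (spectra φ).obj V ⟶ (spectra φ).obj V := Spec.map (CommRingCat.ofHom V.ringEnd)

theorem chart_comp : V.chart ≫ φ = V.specEnd ≫ V.chart :=
  (V.2.1.SpecMap_appLE_fromSpec φ V.2.1 V.2.2.ge).symm

theorem specEnd_comp_quotientMap :
    V.specEnd ≫ (quotientMap φ).app V = (quotientMap φ).app V := by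
  change Spec.map _ ≫ Spec.map _ = Spec.map _
  rw [← Spec.map_comp]
  congr 1
  ext a
  exact a.2

theorem ringEnd_pow_eq_one {n : ℕ} (hφ : End.of φ ^ n = 1) : V.ringEnd ^ n = 1 := by
  have specEnd_pow : End.of V.specEnd ^ n = 1 := by
    refine (cancel_mono V.chart).mp ?_
    rw [pow_comp_eq_comp_pow (ψ := End.of φ) V.chart_comp.symm, hφ]
    exact (Category.comp_id _).trans (Category.id_comp _).symm
  refine congrArg CommRingCat.Hom.hom (Spec.map_injective (?_ : Spec.map (CommRingCat.ofHom _) = _))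
  rw [Spec_map_pow]
  exact specEnd_pow.trans (Spec.map_id _).symm

section Cover

variable (hinf : ∀ U V : Y.Opens, IsAffineOpen U → IsAffineOpen V → IsAffineOpen (U ⊓ V))

variable (φ) in
/-- The cover of a scheme by the stable affine opens. -/
def openCover (hcov : ∀ y : Y, ∃ V : StableAffineOpens φ, y ∈ V.1) : Y.OpenCover where
  I₀ := StableAffineOpens φ
  X := (spectra φ).obj
  f := chart
  mem₀ := by
    rw [Scheme.presieve₀_mem_precoverage_iff]
    refine ⟨fun y ↦ ?_, inferInstance⟩
    obtain ⟨V, hV⟩ := hcov y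
    rw [← V.opensRange_chart] at hV
    exact ⟨V, hV⟩

include hinf in
theorem exists_map_eq_of_chart_eq {V W : StableAffineOpens φ} (x : (spectra φ).obj V)
    (y : (spectra φ).obj W) (hxy : V.chart x = W.chart y) :
    ∃ (L : StableAffineOpens φ) (f : L ⟶ V) (g : L ⟶ W) (z : (spectra φ).obj L),
      (spectra φ).map f z = x ∧ (spectra φ).map g z = y := by
  let L : StableAffineOpens φ := ⟨V.1 ⊓ W.1, hinf _ _ V.2.1 W.2.1, by
    rw [Scheme.Hom.preimage_inf, V.2.2, W.2.2]⟩
  have hx : V.chart x ∈ V.1 := by rw [← V.opensRange_chart]; exact ⟨x, rfl⟩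
  have hy : W.chart y ∈ W.1 := by rw [← W.opensRange_chart]; exact ⟨y, rfl⟩
  obtain ⟨z, hz⟩ : V.chart x ∈ L.chart.opensRange := by
    rw [L.opensRange_chart]
    exact ⟨hx, hxy ▸ hy⟩
  refine ⟨L, homOfLE (inf_le_left (a := V.1) (b := W.1)),
    homOfLE (inf_le_right (a := V.1) (b := W.1)), z, ?_, ?_⟩
  · apply V.chart.isOpenEmbedding.injective
    rw [← Scheme.Hom.comp_apply, map_chart]
    exact hz
  · apply W.chart.isOpenEmbedding.injective
    rw [← Scheme.Hom.comp_apply, map_chart]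
    exact hz.trans hxy

variable (hcov : ∀ y : Y, ∃ V : StableAffineOpens φ, y ∈ V.1)

instance : Category (openCover φ hcov).I₀ := inferInstanceAs (Category (StableAffineOpens φ))

/-- The cover by the stable affine opens is directed by inclusion if the intersection of two affine
opens is affine. -/
abbrev locallyDirected : (openCover φ hcov).LocallyDirected where
  trans f := (spectra φ).map f
  trans_id := (spectra φ).map_id
  trans_comp := (spectra φ).map_comp
  w := map_chart
  directed {V W : StableAffineOpens φ} (x : ↥(pullback V.chart W.chart)) := by
    obtain ⟨L, f, g, z, hz, -⟩ := exists_map_eq_of_chart_eq hinf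
      (pullback.fst V.chart W.chart x) (pullback.snd V.chart W.chart x)
      congr($(pullback.condition (f := V.chart) (g := W.chart)) x)
    refine ⟨L, f, g, z, (pullback.fst V.chart W.chart).isOpenEmbedding.injective ?_⟩
    rw [← hz]
    exact congr($(pullback.lift_fst (f := V.chart) (g := W.chart) _ _ _) z)
  property_trans f := isOpenImmersion_spectra_map f

include hinf hcov in
theorem isLocallyDirected_spectra : (spectra φ ⋙ Scheme.forget).IsLocallyDirected :=
  let := locallyDirected hinf hcov
  inferInstanceAs ((openCover φ hcov).functorOfLocallyDirected ⋙ Scheme.forget).IsLocallyDirected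

variable (φ) in
/-- The cocone of the inclusions of the stable affine opens. -/
def chartCocone : Cocone (spectra φ) :=
  ⟨Y, { app := chart
        naturality := fun _ _ f ↦ (map_chart f).trans (Category.comp_id _).symm }⟩

/-- A scheme with affine intersections is the colimit of its stable affine opens if they cover. -/
def isColimitChartCocone : IsColimit (chartCocone φ) :=
  let := locallyDirected hinf hcov
  (openCover φ hcov).isColimitCoconeOfLocallyDirected

end Cover

section Scalars

variable {k K : Type u} [Field k] [Field K] [Algebra k K] {F : K →ₐ[k] K} {r : Y ⟶ Spec (.of K)}
  (hr : φ ≫ r = r ≫ (specMap F).left)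

variable (r) in
/-- The structure morphism of the ring of functions on a stable affine open. -/
def scalars : K →+* Γ(Y, V.1) := (Spec.preimage (V.chart ≫ r)).hom

theorem Spec_map_scalars : Spec.map (CommRingCat.ofHom (V.scalars r)) = V.chart ≫ r :=
  Spec.map_preimage _

include hr in
theorem ringEnd_comp_scalars :
    V.ringEnd.comp (V.scalars r) = (V.scalars r).comp (F : K →+* K) := by
  refine congrArg CommRingCat.Hom.hom (Spec.map_injective (?_ : Spec.map (CommRingCat.ofHom _) = _))
  rw [CommRingCat.ofHom_comp, Spec.map_comp, Spec_map_scalars]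
  calc V.specEnd ≫ V.chart ≫ r = V.chart ≫ φ ≫ r := (reassoc_of% V.chart_comp) r |>.symm
    _ = (V.chart ≫ r) ≫ (specMap F).left := by rw [hr, Category.assoc]
    _ = _ := by rw [← Spec_map_scalars]; exact (Spec.map_comp _ _).symm

/-- The structure morphism of the quotient of a stable affine open. -/
def structureMap : (quotients φ).obj V ⟶ Spec (.of k) :=
  Spec.map (CommRingCat.ofHom (toInvariants (V.ringEnd_comp_scalars hr)))

theorem map_structureMap {V W : StableAffineOpens φ} (f : V ⟶ W) :
    (quotients φ).map f ≫ W.structureMap hr = V.structureMap hr := by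
  have restrict_scalars : CommRingCat.ofHom (W.scalars r) ≫ Y.presheaf.map (homOfLE f.le).op =
      CommRingCat.ofHom (V.scalars r) := by
    apply Spec.map_injective
    rw [Spec.map_comp, Spec_map_scalars, Spec_map_scalars, ← map_chart f, Category.assoc]
  rw [structureMap, structureMap, ← Spec.map_comp]
  congr 1
  ext c
  exact congr($restrict_scalars (algebraMap k K c))

variable [FiniteDimensional k K] (hF : orderOf F = finrank k K)
  (hφ : End.of φ ^ finrank k K = 1)

include hF hφ

theorem isPullback_structureMap :
    IsPullback ((quotientMap φ).app V) (V.chart ≫ r) (V.structureMap hr) (specOver k K).hom := by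
  rw [← Spec_map_scalars]
  exact isPullback_Spec_invariants hF (V.ringEnd_comp_scalars hr) (V.ringEnd_pow_eq_one hφ)

include hr in
theorem equifibered_quotientMap : (quotientMap φ).Equifibered := fun V W f ↦ by
  refine (IsPullback.of_bot ?_ ((quotientMap φ).naturality f).symm
    (W.isPullback_structureMap hr hF hφ)).flip
  rw [map_structureMap, ← Category.assoc, map_chart]
  exact V.isPullback_structureMap hr hF hφ

include hr in
theorem isOpenImmersion_quotients_map {V W : StableAffineOpens φ} (f : V ⟶ W) :
    IsOpenImmersion ((quotients φ).map f) :=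
  MorphismProperty.of_isPullback_of_descendsAlong (P := @IsOpenImmersion)
    (Q := @Surjective ⊓ @Flat ⊓ @QuasiCompact) (equifibered_quotientMap hr hF hφ f)
    (surjective_flat_quasiCompact_of_isPullback (W.isPullback_structureMap hr hF hφ))
    (isOpenImmersion_spectra_map f)

end Scalars

end StableAffineOpens

open StableAffineOpens

theorem exists_quotient {k K : Type u} [Field k] [Field K] [Algebra k K] [FiniteDimensional k K]
    {F : K →ₐ[k] K} (hF : orderOf F = finrank k K) {r : Y ⟶ Spec (.of K)}
    (hr : φ ≫ r = r ≫ (specMap F).left) (hφ : End.of φ ^ finrank k K = 1)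
    (hinf : ∀ U V : Y.Opens, IsAffineOpen U → IsAffineOpen V → IsAffineOpen (U ⊓ V))
    (hcov : ∀ y : Y, ∃ V : StableAffineOpens φ, y ∈ V.1) :
    ∃ (T : Scheme.{u}) (π : T ⟶ Spec (.of k)) (p : Y ⟶ T), φ ≫ p = p ∧
      IsPullback p r π (specOver k K).hom := by
  have equifibered := equifibered_quotientMap hr hF hφ
  have isPullback_chart (V : StableAffineOpens φ) := V.isPullback_structureMap hr hF hφ
  have surjective (V : StableAffineOpens φ) : Surjective ((quotientMap φ).app V) :=
    (surjective_flat_quasiCompact_of_isPullback (isPullback_chart V)).1.1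
  have {V W : StableAffineOpens φ} (f : V ⟶ W) := isOpenImmersion_quotients_map hr hF hφ f
  have := isLocallyDirected_spectra hinf hcov
  have := isLocallyDirected_of_equifibered_of_surjective equifibered surjective
  let isColimit := isColimitChartCocone hinf hcov
  let p : Y ⟶ colimit (quotients φ) := isColimit.map (colimit.cocone _) (quotientMap φ)
  have isPullback_p (V) : IsPullback V.chart ((quotientMap φ).app V) p (colimit.ι _ V) :=
    isPullback_map_of_equifibered equifibered isColimit V
  let π : colimit (quotients φ) ⟶ Spec (.of k) := colimit.desc (quotients φ)
    ⟨Spec (.of k), fun V ↦ V.structureMap hr, fun V W f ↦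
      (map_structureMap hr f).trans (Category.comp_id _).symm⟩
  have isPullback_π (V : StableAffineOpens φ) : IsPullback ((quotientMap φ).app V) (V.chart ≫ r)
      (colimit.ι (quotients φ) V ≫ π) (specOver k K).hom := by
    rw [colimit.ι_desc]
    exact isPullback_chart V
  have φ_comp_p : φ ≫ p = p := isColimit.hom_ext fun V ↦ by
    change V.chart ≫ φ ≫ p = V.chart ≫ p
    rw [reassoc_of% V.chart_comp, (isPullback_p V).w, reassoc_of% V.specEnd_comp_quotientMap]
  exact ⟨colimit (quotients φ), π, p, φ_comp_p, isPullback_of_openCover_of_isPullback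
    (Scheme.IsLocallyDirected.openCover (quotients φ)) isPullback_p isPullback_π⟩

end Quotient

/-! ### Descent of torsors -/

section DescentOfActions

variable {C : Type w} [Category.{v} C] [CartesianMonoidalCategory C] {G Y T : C}

theorem isPullback_whiskerLeft_snd (p : Y ⟶ T) : IsPullback (G ◁ p) (snd G Y) (snd G T) p := by
  refine ⟨⟨by simp⟩, ⟨PullbackCone.IsLimit.mk _ (fun s ↦ lift (s.fst ≫ fst G T) s.snd) ?_ ?_ ?_⟩⟩
  · intro s
    ext
    · simp
    · simpa using s.condition.symm
  · intro s
    simp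
  · intro s m h₁ h₂
    ext
    · simp [← h₁]
    · simpa using h₂

theorem epi_whiskerLeft {p : Y ⟶ T} (hp : (MorphismProperty.epimorphisms C).universally p) :
    Epi (G ◁ p) :=
  hp _ _ _ (isPullback_whiskerLeft_snd p)

variable [MonObj G] [ModObj G Y]

/-- The action of `G` on `T` induced by an action on `Y` through a universal epimorphism. -/
abbrev descendedAction {p : Y ⟶ T} (hp : (MorphismProperty.epimorphisms C).universally p)
    (a : G ⊗ T ⟶ T) (ha : γ[G,Y] ≫ p = G ◁ p ≫ a) : ModObj G T where
  smul := a
  one_smul := by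
    have := epi_whiskerLeft (G := 𝟙_ C) hp
    change η[G] ▷ T ≫ a = (λ_ T).hom
    rw [← cancel_epi (𝟙_ C ◁ p), whisker_exchange_assoc, ← ha, leftUnitor_naturality,
      reassoc_of% ModObj.one_smul_self G Y]
  mul_smul := by
    have := epi_whiskerLeft (G := G ⊗ G) hp
    change μ[G] ▷ T ≫ a = (α_ G G T).hom ≫ G ◁ a ≫ a
    rw [← cancel_epi ((G ⊗ G) ◁ p), whisker_exchange_assoc, ← ha,
      reassoc_of% ModObj.mul_smul_self G Y, tensor_whiskerLeft]
    simp only [Category.assoc, Iso.inv_hom_id_assoc, ← whiskerLeft_comp_assoc, ← ha]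
    rw [whiskerLeft_comp_assoc, ha]

variable [ModObj G T] {X : C} [ModObj G X] {p : Y ⟶ T} [IsModHom G p] [Epi (G ◁ p)]

theorem isModHom_of_isModHom_comp {f : T ⟶ X} (h : IsModHom G (p ≫ f)) : IsModHom G f where
  smul_hom := by
    rw [← cancel_epi (G ◁ p)]
    have hp : γ[G,Y] ≫ p = G ◁ p ≫ γ[G,T] := IsModHom.smul_hom
    have hpf : γ[G,Y] ≫ p ≫ f = G ◁ (p ≫ f) ≫ γ[G,X] := IsModHom.smul_hom
    change G ◁ p ≫ γ[G,T] ≫ f = G ◁ p ≫ G ◁ f ≫ γ[G,X]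
    rw [← reassoc_of% hp, hpf, whiskerLeft_comp_assoc]

theorem smul_comp_eq_snd_comp_of_epi {S : C} {π : T ⟶ S}
    (h : γ[G,Y] ≫ p ≫ π = snd G Y ≫ p ≫ π) : γ[G,T] ≫ π = snd G T ≫ π := by
  have hp : γ[G,Y] ≫ p = G ◁ p ≫ γ[G,T] := IsModHom.smul_hom
  rw [← cancel_epi (G ◁ p), ← reassoc_of% hp, h, whiskerLeft_snd_assoc]

end DescentOfActions

section TorsorDescent

open Module

theorem isPullback_of_isPullback_comp_left {A B D A' B' D' : Scheme.{u}} {a : A ⟶ B} {b : B ⟶ D}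
    {a' : A' ⟶ B'} {b' : B' ⟶ D'} {l : A ⟶ A'} {m : B ⟶ B'} {n : D ⟶ D'}
    [Surjective a'] [Flat a'] [QuasiCompact a'] (h_left : IsPullback a l m a')
    (h_outer : IsPullback (a ≫ b) l n (a' ≫ b')) (w : b ≫ n = m ≫ b') : IsPullback b m n b' := by
  let c : B ⟶ pullback n b' := pullback.lift b m w
  have c_fst : c ≫ pullback.fst n b' = b := pullback.lift_fst _ _ _
  have c_snd : c ≫ pullback.snd n b' = m := pullback.lift_snd _ _ _
  have h_cover : IsPullback (pullback.fst (pullback.snd n b') a')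
    (pullback.snd (pullback.snd n b') a') (pullback.snd n b') a' := .of_hasPullback _ _
  have h_total := h_cover.paste_horiz (.of_hasPullback n b')
  let e := h_outer.isoIsPullback _ _ h_total
  have e_fst : e.hom ≫ pullback.fst (pullback.snd n b') a' = a ≫ c := by
    apply pullback.hom_ext
    · rw [Category.assoc, Category.assoc, c_fst, h_outer.isoIsPullback_hom_fst]
    · rw [Category.assoc, Category.assoc, c_snd, pullback.condition,
        h_outer.isoIsPullback_hom_snd_assoc, h_left.w]
  have h_c : IsPullback a e.hom c (pullback.fst (pullback.snd n b') a') :=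
    .of_bot (by rwa [c_snd, h_outer.isoIsPullback_hom_snd]) e_fst.symm h_cover
  have : IsIso c := MorphismProperty.of_isPullback_of_descendsAlong
    (P := MorphismProperty.isomorphisms Scheme) (Q := @Surjective ⊓ @Flat ⊓ @QuasiCompact) h_c.flip
    ⟨⟨inferInstance, inferInstance⟩, inferInstance⟩ (inferInstanceAs (IsIso e.hom))
  exact .of_iso_pullback ⟨w⟩ (asIso c) c_fst c_snd

/-- The morphism `Spec K → Spec k'` over `k` of a tower `k ⊆ k' ⊆ K`. -/
abbrev towerMap (k k' K : Type u) [Field k] [Field k'] [Field K] [Algebra k k'] [Algebra k K]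
    [Algebra k' K] [IsScalarTower k k' K] : specOver k K ⟶ specOver k k' :=
  specMap (IsScalarTower.toAlgHom k k' K)

variable {k k' K : Type u} [Field k] [Field k'] [Field K] [Algebra k k'] [Algebra k K]
  [Algebra k' K] [IsScalarTower k k' K]

variable {T T' S : Over (Spec (.of k))} {p : T' ⟶ T} {r : T' ⟶ specOver k K} {π : T ⟶ specOver k k'}

theorem isPullback_left (h : IsPullback p r π (towerMap k k' K)) :
    IsPullback p.left r.left π.left (specOver k' K).hom :=
  h.map (Over.forget _)

theorem epimorphisms_universally_of_isPullback (h : IsPullback p r π (towerMap k k' K)) :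
    (MorphismProperty.epimorphisms _).universally p := by
  intro Z' Z t' t q hq
  obtain ⟨⟨_, _⟩, _⟩ := surjective_flat_quasiCompact_of_isPullback
    (isPullback_left (hq.paste_vert h))
  have : Epi q.left := inferInstance
  exact (Over.forget _).epi_of_epi_map this

theorem exists_comp_eq_of_comp_eq_self_over [FiniteDimensional k' K] {F : K →ₐ[k'] K}
    (hF : orderOf F = finrank k' K) (h : IsPullback p r π (towerMap k k' K)) {φ : T' ⟶ T'}
    (hp : φ ≫ p = p) (hr : φ ≫ r = r ≫ specMap (F.restrictScalars k)) {f : T' ⟶ S}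
    (hf : φ ≫ f = f) : ∃ f' : T ⟶ S, p ≫ f' = f := by
  obtain ⟨f', hf'⟩ := exists_comp_eq_of_comp_eq_self hF (isPullback_left h)
    (congrArg (·.left) hp) (congrArg (·.left) hr) (congrArg (·.left) hf)
  obtain ⟨⟨_, _⟩, _⟩ := surjective_flat_quasiCompact_of_isPullback (isPullback_left h)
  refine ⟨Over.homMk f' ?_, by ext1; exact hf'⟩
  rw [← cancel_epi p.left, ← Category.assoc, hf', Over.w, Over.w]

variable {G X : Over (Spec (.of k))} [GrpObj G]

theorem IsTorsor.of_isPullback [ModObj G T] [ModObj G T'] (hr : IsTorsor G r) [IsModHom G p]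
    (h : IsPullback p r π (towerMap k k' K)) : IsTorsor G π := by
  have smul_comp_p : γ[G,T'] ≫ p = G ◁ p ≫ γ[G,T] := IsModHom.smul_hom
  have := epi_whiskerLeft (G := G) (epimorphisms_universally_of_isPullback h)
  have smul_comp_π : γ[G,T] ≫ π = snd G T ≫ π := smul_comp_eq_snd_comp_of_epi (p := p) <| by
    rw [h.w, reassoc_of% hr.isPullback.w]
  have := hr.surjective
  obtain ⟨⟨_, _⟩, _⟩ := surjective_flat_quasiCompact_of_isPullback (isPullback_left h)
  have h_spec : (@Surjective ⊓ @Flat ⊓ @QuasiCompact : MorphismProperty Scheme)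
      (specOver k' K).hom :=
    surjective_flat_quasiCompact_of_isPullback (IsPullback.id_vert _)
  have := h_spec.1.1
  have h_outer : IsPullback (G ◁ p ≫ γ[G,T]) (snd G T') π (p ≫ π) := by
    rw [← smul_comp_p, h.w]
    exact hr.isPullback.paste_horiz h
  exact
    { flat := inferInstanceAs (Flat (Y := Spec (.of k')) π.left)
      surjective := by
        have : Surjective (p.left ≫ π.left) := by
          rw [(isPullback_left h).w]
          infer_instance
        exact .of_comp p.left π.left
      locallyOfFinitePresentation := MorphismProperty.of_isPullback_of_descendsAlong
        (isPullback_left h).flip h_spec hr.locallyOfFinitePresentation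
      isPullback := .of_map (Over.forget _) smul_comp_π
        (isPullback_of_isPullback_comp_left (a := (G ◁ p).left) (a' := p.left)
          (l := (snd G T').left) ((isPullback_whiskerLeft_snd p).map (Over.forget _))
          (h_outer.map (Over.forget _)) (congrArg (·.left) smul_comp_π)) }

variable [ModObj G X] [FiniteDimensional k' K] {F : K →ₐ[k'] K}

theorem QuotientStack.exists_descent (hF : orderOf F = finrank k' K)
    (N : QuotientStack G X (specOver k K)) {φ : N.T ⟶ N.T} [IsModHom G φ]
    (hπ : φ ≫ N.π = N.π ≫ specMap (F.restrictScalars k)) (hf : φ ≫ N.f = N.f) {p : N.T ⟶ T}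
    (hp : φ ≫ p = p) (h : IsPullback p N.π π (towerMap k k' K)) :
    ∃ (M : QuotientStack G X (specOver k k')) (q : N.T ⟶ M.T), IsModHom G q ∧
      IsPullback q N.π M.π (towerMap k k' K) ∧ q ≫ M.f = N.f := by
  have hφ : γ[G,N.T] ≫ φ = G ◁ φ ≫ γ[G,N.T] := IsModHom.smul_hom
  have epi_p := epimorphisms_universally_of_isPullback h
  obtain ⟨a, ha⟩ : ∃ a : G ⊗ T ⟶ T, G ◁ p ≫ a = γ[G,N.T] ≫ p := by
    refine exists_comp_eq_of_comp_eq_self_over hF ((isPullback_whiskerLeft_snd p).paste_vert h)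
      (φ := G ◁ φ) ?_ ?_ ?_
    · rw [← whiskerLeft_comp, hp]
    · rw [whiskerLeft_snd_assoc, hπ, Category.assoc]
    · rw [← reassoc_of% hφ, hp]
  obtain ⟨f, hpf⟩ := exists_comp_eq_of_comp_eq_self_over hF h hp hπ hf
  let := descendedAction epi_p a ha.symm
  have isModHom_p : IsModHom G p := ⟨ha.symm⟩
  have := epi_whiskerLeft (G := G) epi_p
  have isModHom_f : IsModHom G f := isModHom_of_isModHom_comp (p := p) (hpf ▸ N.equivariant)
  exact ⟨⟨T, π, N.torsor.of_isPullback h, f⟩, p, isModHom_p, h, hpf⟩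

end TorsorDescent

/-! ### Points over subextensions of a field -/

section Points

variable {k : Type u} [Field k] {Z : Over (Spec (.of k))}

theorem epi_specMap {K L : Type u} [Field K] [Field L] [Algebra k K] [Algebra k L]
    (f : K →ₐ[k] L) : Epi (specMap f) := by
  let := f.toRingHom.toAlgebra
  have : Surjective (Spec.map (CommRingCat.ofHom f.toRingHom)) :=
    ⟨Function.surjective_to_subsingleton (α := Spec (.of L)) (β := Spec (.of K)) _⟩
  have : Flat (Spec.map (CommRingCat.ofHom f.toRingHom)) :=
    inferInstanceAs (Flat (Y := Spec (.of K)) _)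
  have : Epi (specMap f).left :=
    inferInstanceAs (Epi (Spec.map (CommRingCat.ofHom f.toRingHom)))
  exact (Over.forget _).epi_of_epi_map this

theorem specMap_injective {A B : Type u} [CommRing A] [CommRing B] [Algebra k A] [Algebra k B] :
    Function.Injective (specMap (k := k) (A := A) (B := B)) := by
  intro f g h
  have := Spec.map_injective (congrArg (·.left) h)
  ext r
  exact congrArg (fun g ↦ g.hom r) this

theorem specMap_surjective {A B : Type u} [CommRing A] [CommRing B] [Algebra k A] [Algebra k B] :
    Function.Surjective (specMap (k := k) (A := A) (B := B)) := by
  intro h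
  let f := (Spec.preimage h.left).hom
  have hf : Spec.map (CommRingCat.ofHom f) = h.left := Spec.map_preimage h.left
  have comp_eq : f.comp (algebraMap k A) = algebraMap k B := by
    have w : h.left ≫ Spec.map (CommRingCat.ofHom (algebraMap k A)) =
      Spec.map (CommRingCat.ofHom (algebraMap k B)) := Over.w h
    rw [← hf, ← Spec.map_comp, ← CommRingCat.ofHom_comp] at w
    exact congrArg CommRingCat.Hom.hom (Spec.map_injective w)
  exact ⟨{ f with commutes' := RingHom.congr_fun comp_eq }, by ext1; exact hf⟩

theorem exists_specOver_hom_left_eq (A : CommRingCat.{u}) (j : Spec A ⟶ Z.left) :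
    ∃ (_ : Algebra k A) (j' : specOver k A ⟶ Z), j'.left = j := by
  let := (Spec.preimage (j ≫ Z.hom)).hom.toAlgebra
  exact ⟨this, Over.homMk j (Spec.map_preimage (j ≫ Z.hom)).symm, rfl⟩

theorem finiteType_of_isOpenImmersion [LocallyOfFiniteType Z.hom] {A : Type u} [CommRing A]
    [Algebra k A] (j : specOver k A ⟶ Z) [IsOpenImmersion j.left] : Algebra.FiniteType k A := by
  have : LocallyOfFiniteType (Spec.map (CommRingCat.ofHom (algebraMap k A))) := by
    have w : j.left ≫ Z.hom = Spec.map (CommRingCat.ofHom (algebraMap k A)) := Over.w j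
    rw [← w]
    infer_instance
  exact RingHom.finiteType_algebraMap.mp (HasRingHomProperty.Spec_iff.mp this)

variable {L : Type u} [Field L] [Algebra k L]

theorem exists_specMap_comp_eq {A : Type u} [CommRing A] [Algebra k A] (j : specOver k A ⟶ Z)
    [IsOpenImmersion j.left] (z : specOver k L ⟶ Z)
    (hz : z.left (IsLocalRing.closedPoint L : Spec (.of L)) ∈ Set.range j.left) :
    ∃ f : A →ₐ[k] L, specMap f ≫ j = z := by
  have range_subset : Set.range z.left ⊆ Set.range j.left := by
    rintro _ ⟨y, rfl⟩
    rwa [Subsingleton.elim (α := Spec (.of L)) y (IsLocalRing.closedPoint L : Spec (.of L))]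
  obtain ⟨f, hf⟩ := specMap_surjective (k := k) (A := A) (B := L)
    (Over.homMk (IsOpenImmersion.lift j.left z.left range_subset) (by
      rw [← Over.w j, IsOpenImmersion.lift_fac_assoc, Over.w]))
  refine ⟨f, ?_⟩
  rw [hf]
  ext1
  exact IsOpenImmersion.lift_fac _ _ _

theorem exists_isOpenImmersion_specMap_comp_eq (z : specOver k L ⟶ Z) :
    ∃ (A : CommRingCat.{u}) (_ : Algebra k A) (j : specOver k A ⟶ Z) (f : A →ₐ[k] L),
      IsOpenImmersion j.left ∧ specMap f ≫ j = z := by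
  obtain ⟨i, hi⟩ := Z.left.affineCover.exists_eq (z.left (IsLocalRing.closedPoint L : Spec (.of L)))
  have : IsOpenImmersion (Z.left.affineCover.f i) := Z.left.affineCover.map_prop i
  obtain ⟨_, j, hj⟩ := exists_specOver_hom_left_eq _ (Z.left.affineCover.f i)
  have : IsOpenImmersion j.left := hj ▸ this
  obtain ⟨f, hf⟩ := exists_specMap_comp_eq j z (hj ▸ hi)
  exact ⟨_, _, j, f, this, hf⟩

theorem finite_algHom {A L : Type*} [CommRing A] [Algebra k A] [Algebra.FiniteType k A]
    [CommRing L] [Algebra k L] [Finite L] : Finite (A →ₐ[k] L) := by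
  obtain ⟨s, hs⟩ := Algebra.FiniteType.out (R := k) (A := A)
  refine Finite.of_injective (fun f : A →ₐ[k] L ↦ fun a : s ↦ f a) fun f g h ↦ ?_
  exact AlgHom.ext_of_adjoin_eq_top hs fun a ha ↦ congrFun h ⟨a, ha⟩

variable (Z L) in
theorem finite_points [LocallyOfFiniteType Z.hom] [QuasiCompact Z.hom] [Finite L] :
    Finite (specOver k L ⟶ Z) := by
  have : CompactSpace Z.left := (quasiCompact_iff_compactSpace (f := Z.hom)).mp ‹_›
  let 𝒰 := Z.left.affineCover.finiteSubcover
  have finite_chart (i : 𝒰.I₀) : {z : specOver k L ⟶ Z |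
      z.left (IsLocalRing.closedPoint L : Spec (.of L)) ∈ Set.range (𝒰.f i)}.Finite := by
    obtain ⟨R, j, hj, hr⟩ : ∃ (R : CommRingCat.{u}) (j : Spec R ⟶ Z.left), IsOpenImmersion j ∧
      Set.range j = Set.range (𝒰.f i) := ⟨_, 𝒰.f i, 𝒰.map_prop i, rfl⟩
    obtain ⟨_, j', rfl⟩ := exists_specOver_hom_left_eq R j
    have := finiteType_of_isOpenImmersion j'
    have := finite_algHom (k := k) (A := R) (L := L)
    refine (Set.finite_range fun f : R →ₐ[k] L ↦ specMap f ≫ j').subset fun z hz ↦ ?_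
    exact exists_specMap_comp_eq j' z (hr ▸ hz)
  refine Set.finite_univ_iff.mp ((Set.finite_iUnion finite_chart).subset fun z _ ↦ ?_)
  obtain ⟨i, x, hx⟩ := 𝒰.exists_eq (z.left (IsLocalRing.closedPoint L : Spec (.of L)))
  exact Set.mem_iUnion.mpr ⟨i, x, hx⟩

end Points

section FieldOfDefinition

variable {k k' L : Type u} [Field k] [Field k'] [Field L] [Algebra k k'] [Algebra k L]
  [Algebra k' L] [IsScalarTower k k' L] {Z : Over (Spec (.of k))}

instance (K : IntermediateField k' L) : IsScalarTower k K L :=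
  .of_algebraMap_eq fun _ ↦ rfl

/-- An `L`-point of a `k`-scheme is defined over a subextension `K` of `L/k'` if it comes from a
`K`-point. -/
def IsDefinedOver (K : IntermediateField k' L) (z : specOver k L ⟶ Z) : Prop :=
  ∃ z' : specOver k K ⟶ Z, towerMap k K L ≫ z' = z

theorem IsDefinedOver.mono {K K' : IntermediateField k' L} (h : K ≤ K') {z : specOver k L ⟶ Z}
    (hz : IsDefinedOver K z) : IsDefinedOver K' z := by
  obtain ⟨z', rfl⟩ := hz
  refine ⟨specMap ((IntermediateField.inclusion h).restrictScalars k) ≫ z', ?_⟩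
  rw [← Category.assoc, ← specMap_comp]
  rfl

theorem isDefinedOver_specMap_comp {A : Type u} [CommRing A] [Algebra k A]
    (j : specOver k A ⟶ Z) (f : A →ₐ[k] L) {K : IntermediateField k' L} (h : ∀ a, f a ∈ K) :
    IsDefinedOver K (specMap f ≫ j) := by
  let f' : A →ₐ[k] K := f.codRestrict (K.toSubalgebra.restrictScalars k) h
  refine ⟨specMap f' ≫ j, ?_⟩
  rw [← Category.assoc, ← specMap_comp]
  rfl

theorem exists_finiteDimensional_isDefinedOver [Algebra.IsAlgebraic k' L]
    [LocallyOfFiniteType Z.hom] (z : specOver k L ⟶ Z) :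
    ∃ K : IntermediateField k' L, FiniteDimensional k' K ∧ IsDefinedOver K z := by
  obtain ⟨A, _, j, f, _, rfl⟩ := exists_isOpenImmersion_specMap_comp_eq z
  have := finiteType_of_isOpenImmersion j
  obtain ⟨s, hs⟩ := Algebra.FiniteType.out (R := k) (A := A)
  have : Finite (f '' s) := (s.finite_toSet.image f).to_subtype
  let K := IntermediateField.adjoin k' (f '' s)
  have adjoin_le : Algebra.adjoin k (s : Set A) ≤ (K.toSubalgebra.restrictScalars k).comap f :=
    Algebra.adjoin_le fun b hb ↦ IntermediateField.subset_adjoin _ _ ⟨b, hb, rfl⟩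
  exact ⟨K, IntermediateField.finiteDimensional_adjoin fun x _ ↦ Algebra.IsIntegral.isIntegral x,
    isDefinedOver_specMap_comp j f fun a ↦ adjoin_le (hs ▸ Algebra.mem_top)⟩

/-- The Frobenius of a `k'`-algebra over the finite field `k'`, as an endomorphism of its
spectrum over the smaller field `k`. -/
abbrev frob (k k' L : Type u) [Field k] [Field k'] [Fintype k'] [Field L] [Algebra k k']
    [Algebra k L] [Algebra k' L] [IsScalarTower k k' L] : specOver k L ⟶ specOver k L :=
  specMap ((FiniteField.frobeniusAlgHom k' L).restrictScalars k)

theorem frob_comp_towerMap [Fintype k'] (K : IntermediateField k' L) :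
    frob k k' L ≫ towerMap k K L = towerMap k K L ≫ frob k k' K := by
  rw [← specMap_comp, ← specMap_comp]
  rfl

theorem finite_setOf_pow_eq_self (L : Type*) [Field L] {N : ℕ} (hN : 1 < N) :
    {a : L | a ^ N = a}.Finite := by
  have h := Polynomial.rootSet_finite (Polynomial.X ^ N - Polynomial.X : Polynomial L) L
  refine h.subset fun a ha ↦ ?_
  refine (Polynomial.mem_rootSet_of_ne (FiniteField.X_pow_card_sub_X_ne_zero L hN)).mpr ?_
  have pow_eq : a ^ N = a := ha
  simp [pow_eq]

/-- The coordinates of such a point are roots of some `X ^ N - X`, so they generate a finite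
extension even if there are infinitely many of them. -/
theorem exists_finiteDimensional_isDefinedOver_of_frob_pow [Fintype k'] [Algebra.IsAlgebraic k' L]
    {z : specOver k L ⟶ Z} {n : ℕ} (hn : 0 < n)
    (hz : (End.of (frob k k' L) ^ n : End _) ≫ z = z) :
    ∃ K : IntermediateField k' L, FiniteDimensional k' K ∧ IsDefinedOver K z := by
  obtain ⟨A, _, j, f, _, rfl⟩ := exists_isOpenImmersion_specMap_comp_eq z
  have : Mono j := (Over.forget _).mono_of_mono_map (inferInstanceAs (Mono j.left))
  rw [← specMap_pow, ← Category.assoc, cancel_mono, ← specMap_comp] at hz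
  let s : Set L := {a | a ^ Fintype.card k' ^ n = a}
  have frob_fixed (a : A) : f a ∈ s := by
    have h := DFunLike.congr_fun (specMap_injective hz) a
    rwa [AlgHom.comp_apply, AlgHom.coe_pow, AlgHom.coe_restrictScalars',
      FiniteField.coe_frobeniusAlgHom, pow_iterate] at h
  have : Finite s :=
    (finite_setOf_pow_eq_self L (Nat.one_lt_pow hn.ne' Fintype.one_lt_card)).to_subtype
  exact ⟨IntermediateField.adjoin k' s,
    IntermediateField.finiteDimensional_adjoin fun x _ ↦ Algebra.IsIntegral.isIntegral x,
    isDefinedOver_specMap_comp j f fun a ↦ IntermediateField.subset_adjoin _ _ (frob_fixed a)⟩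

theorem exists_intermediateField_finrank_eq (k' L : Type*) [Field k'] [Field L] [Algebra k' L]
    [Finite k'] [IsAlgClosed L] (n : ℕ) [NeZero n] :
    ∃ K : IntermediateField k' L, FiniteDimensional k' K ∧ Module.finrank k' K = n := by
  obtain ⟨p, _⟩ := CharP.exists k'
  have : Fact p.Prime := ⟨CharP.char_is_prime k' p⟩
  let f : FiniteField.Extension k' p n →ₐ[k'] L := IsAlgClosed.lift
  let e : FiniteField.Extension k' p n ≃ₗ[k'] f.fieldRange :=
    (AlgEquiv.ofInjectiveField f).toLinearEquiv
  exact ⟨f.fieldRange, Module.Finite.equiv e,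
    e.finrank_eq.symm.trans (FiniteField.finrank_extension k' p n)⟩

end FieldOfDefinition

/-! ### Twisted endomorphisms of the trivial torsor -/

section TranslationAction

variable {C : Type w} [Category.{v} C] [CartesianMonoidalCategory C] {G S Z : C} [MonObj G]

theorem translationAction_smul_fst (g : Z ⟶ G) (t : Z ⟶ G ⊗ S) :
    letI := translationAction G S
    (g • t) ≫ fst G S = g * (t ≫ fst G S) := by
  change (lift g t ≫ lift _ _) ≫ _ = _
  simp [MonObj.comp_mul]

theorem translationAction_smul_snd (g : Z ⟶ G) (t : Z ⟶ G ⊗ S) :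
    letI := translationAction G S
    (g • t) ≫ snd G S = t ≫ snd G S := by
  change (lift g t ≫ lift _ _) ≫ _ = _
  simp

end TranslationAction

section Twist

variable {C : Type w} [Category.{v} C] [CartesianMonoidalCategory C] {G X S S' : C} [GrpObj G]

/-- The crossed powers `s^{i-1}(g) ⋯ s(g) g` of a point `g ∈ G(S)` along an endomorphism `s` of
`S`, where `s` acts on points by precomposition. -/
def crossedPow (s : S ⟶ S) (g : S ⟶ G) : ℕ → (S ⟶ G)
  | 0 => 1
  | i + 1 => (s ≫ crossedPow s g i) * g

theorem comp_crossedPow {s : S ⟶ S} {s' : S' ⟶ S'} {j : S' ⟶ S} (h : s' ≫ j = j ≫ s) (g : S ⟶ G)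
    (i : ℕ) : j ≫ crossedPow s g i = crossedPow s' (j ≫ g) i := by
  induction i with
  | zero => exact MonObj.comp_one _
  | succ i ih => rw [crossedPow, MonObj.comp_mul, ← reassoc_of% h, ih, crossedPow]

theorem pow_comp_eq_crossedPow_smul [ModObj G X] {s : S ⟶ S} {g : S ⟶ G} {x : S ⟶ X}
    (h : s ≫ x = g • x) (i : ℕ) : (End.of s ^ i : End S) ≫ x = crossedPow s g i • x := by
  induction i with
  | zero => exact (Category.id_comp x).trans (one_smul _ x).symm
  | succ i ih =>
    rw [pow_succ, End.mul_def, Category.assoc, ih, ModObj.comp_smul, crossedPow, mul_smul]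
    exact congrArg _ h

theorem crossedPow_eq_iterate (s : S ⟶ S) (g : S ⟶ G) (i : ℕ) :
    crossedPow s g i = (fun z ↦ (s ≫ z) * g)^[i] 1 := by
  induction i with
  | zero => rfl
  | succ i ih => rw [Function.iterate_succ_apply', ← ih, crossedPow]

theorem exists_crossedPow_eq_one (s : S ⟶ S) [Epi s] (g : S ⟶ G)
    (h : (Set.range (crossedPow s g)).Finite) :
    ∃ n, 0 < n ∧ ∀ m, n ∣ m → crossedPow s g m = 1 := by
  let step (z : S ⟶ G) : S ⟶ G := (s ≫ z) * g
  have step_injective : Function.Injective step := fun a b hab ↦ by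
    rwa [mul_left_inj, cancel_epi] at hab
  obtain ⟨i, -, j, -, hij, eq⟩ := Set.infinite_univ.exists_lt_map_eq_of_mapsTo
    (f := crossedPow s g) (fun i _ ↦ Set.mem_range_self i) h
  have periodic : Function.IsPeriodicPt step (j - i) 1 := by
    apply step_injective.iterate i
    rw [← Function.iterate_add_apply, Nat.add_sub_cancel' hij.le, ← crossedPow_eq_iterate,
      ← crossedPow_eq_iterate, eq]
  refine ⟨j - i, Nat.sub_pos_of_lt hij, ?_⟩
  rintro _ ⟨m, rfl⟩
  rw [crossedPow_eq_iterate]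
  exact periodic.mul_const m

/-- The endomorphism `(a, t) ↦ (a g(t)⁻¹, s(t))` of the trivial torsor `G × S`. If `s x = g x`, it
is compatible with the orbit map of `x`, and is a descent datum for the object given by `x`. -/
def twist (s : S ⟶ S) (g : S ⟶ G) : G ⊗ S ⟶ G ⊗ S :=
  lift (fst G S * (snd G S ≫ g)⁻¹) (snd G S ≫ s)

theorem lift_comp_twist (s : S ⟶ S) (g : S ⟶ G) (a : S' ⟶ G) (t : S' ⟶ S) :
    lift a t ≫ twist s g = lift (a * (t ≫ g)⁻¹) (t ≫ s) := by
  simp [twist, comp_lift, MonObj.comp_mul, GrpObj.comp_inv]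

theorem twist_comp_snd (s : S ⟶ S) (g : S ⟶ G) : twist s g ≫ snd G S = snd G S ≫ s :=
  lift_snd _ _

theorem whiskerLeft_comp_twist {s : S ⟶ S} {s' : S' ⟶ S'} {j : S' ⟶ S} (h : s' ≫ j = j ≫ s)
    (g : S ⟶ G) : twist s' (j ≫ g) ≫ G ◁ j = G ◁ j ≫ twist s g := by
  ext1
  · simp [twist, MonObj.comp_mul, GrpObj.comp_inv]
  · simp [twist, h]

theorem twist_pow (s : S ⟶ S) (g : S ⟶ G) (i : ℕ) :
    End.of (twist s g) ^ i = End.of (twist (End.of s ^ i : End S) (crossedPow s g i)) := by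
  induction i with
  | zero =>
    change 𝟙 _ = lift (fst G S * (snd G S ≫ 1)⁻¹) (snd G S ≫ 𝟙 S)
    simp
  | succ i ih =>
    rw [pow_succ, ih, End.mul_def]
    change lift _ _ ≫ twist _ _ = twist _ _
    rw [lift_comp_twist, twist, crossedPow, pow_succ, End.mul_def, MonObj.comp_mul, mul_inv_rev,
      mul_assoc, Category.assoc, Category.assoc]

theorem twist_comp_fst_smul [ModObj G X] {s : S ⟶ S} {g : S ⟶ G} {x : S ⟶ X} (h : s ≫ x = g • x) :
    twist s g ≫ (fst G S • (snd G S ≫ x)) = fst G S • (snd G S ≫ x) := by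
  rw [ModObj.comp_smul, reassoc_of% twist_comp_snd, h, twist, lift_fst, ModObj.comp_smul,
    ← mul_smul, inv_mul_cancel_right]

theorem isModHom_twist (s : S ⟶ S) (g : S ⟶ G) :
    letI := translationAction G S
    IsModHom G (twist s g) :=
  letI := translationAction G S
  isModHom_of_points _ fun h t ↦ by
    ext1
    · rw [translationAction_smul_fst, Category.assoc, Category.assoc, twist, lift_fst,
        MonObj.comp_mul, MonObj.comp_mul, translationAction_smul_fst, GrpObj.comp_inv,
        GrpObj.comp_inv, ← Category.assoc, translationAction_smul_snd, Category.assoc, mul_assoc]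
    · rw [translationAction_smul_snd, Category.assoc, Category.assoc, twist_comp_snd,
        ← Category.assoc, translationAction_smul_snd, Category.assoc]

end Twist

/-! ### Affine opens and closed points of an algebraic group -/

section Separated

variable {C : Type w} [Category.{v} C] [CartesianMonoidalCategory C]

theorem isPullback_diagonal (G : C) [GrpObj G] :
    IsPullback (lift (𝟙 G) (𝟙 G)) (toUnit G) (fst G G * (snd G G)⁻¹) η[G] := by
  have comp_one {Z : C} (f : Z ⟶ 𝟙_ C) : f ≫ η[G] = 1 := by
    rw [Hom.one_def]
    congr 1
    exact toUnit_unique _ _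
  refine ⟨⟨?_⟩, ⟨PullbackCone.IsLimit.mk _ (fun s ↦ s.fst ≫ fst G G) ?_ ?_ ?_⟩⟩
  · rw [comp_one, MonObj.comp_mul, GrpObj.comp_inv, lift_fst, lift_snd, mul_inv_cancel]
  · intro s
    have h := s.condition
    rw [comp_one, MonObj.comp_mul, GrpObj.comp_inv, mul_inv_eq_one] at h
    ext
    · simp
    · simpa using h
  · intro s
    exact toUnit_unique _ _
  · intro s m h _
    simp [← h]

variable {k : Type u} [Field k] (G : Over (Spec (.of k))) [GrpObj G]

theorem isSeparated_hom : IsSeparated G.hom := by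
  have h := (isPullback_diagonal G).map (Over.forget _)
  have : IsClosedImmersion (lift (𝟙 G) (𝟙 G)).left :=
    MorphismProperty.of_isPullback (P := @IsClosedImmersion) h.flip
      (inferInstanceAs (IsClosedImmersion η[G].left))
  exact ⟨this⟩

theorem isAffineOpen_inf (A : Type u) [CommRing A] [Algebra k A]
    {U V : (G ⊗ specOver k A).left.Opens} (hU : IsAffineOpen U) (hV : IsAffineOpen V) :
    IsAffineOpen (U ⊓ V) := by
  have := isSeparated_hom G
  have : IsSeparated (snd G (specOver k A)).left :=
    inferInstanceAs (IsSeparated (pullback.snd G.hom (specOver k A).hom))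
  have : IsSeparated (terminal.from (G ⊗ specOver k A).left) := by
    rw [← terminal.comp_from (snd G (specOver k A)).left]
    have : IsSeparated (terminal.from (specOver k A).left) :=
      inferInstanceAs (IsSeparated (terminal.from (Spec (.of A))))
    infer_instance
  exact hU.inf hV

end Separated

theorem exists_dense_isAffineOpen (Y : Scheme.{u}) [IsNoetherian Y] :
    ∃ U : Y.Opens, IsAffineOpen U ∧ Dense (U : Set Y) := by
  have : WellFoundedGT Y.Opens := inferInstanceAs (TopologicalSpace.NoetherianSpace Y)
  obtain ⟨U, hU, maximal⟩ :=
    this.wf.has_min {U : Y.Opens | IsAffineOpen U} ⟨⊥, isAffineOpen_bot Y⟩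
  refine ⟨U, hU, ?_⟩
  by_contra not_dense
  rw [dense_iff_closure_eq, ← ne_eq, Set.ne_univ_iff_exists_notMem] at not_dense
  obtain ⟨y, hy⟩ := not_dense
  obtain ⟨_, ⟨V, hV, rfl⟩, hyV, hVU⟩ := Y.isBasis_affineOpens.exists_subset_of_mem_open hy
    isClosed_closure.isOpen_compl
  have disjoint : Disjoint U V := by
    rw [← TopologicalSpace.Opens.coe_disjoint, Set.disjoint_left]
    exact fun z hz hz' ↦ hVU hz' (subset_closure hz)
  refine maximal _ (hU.sup_of_disjoint hV disjoint)
    (left_lt_sup.mpr fun h ↦ hy (subset_closure (h hyV)))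

section ImagePt

variable {k : Type u} [Field k] {Z W : Over (Spec (.of k))} {L : Type u} [Field L] [Algebra k L]

/-- The image of a point with values in a field. -/
def imagePt (z : specOver k L ⟶ Z) : Z.left := z.left (IsLocalRing.closedPoint L : Spec (.of L))

theorem imagePt_comp (z : specOver k L ⟶ Z) (f : Z ⟶ W) : imagePt (z ≫ f) = f.left (imagePt z) := by
  rw [imagePt, Over.comp_left]
  rfl

theorem imagePt_comp_left {K : Type u} [Field K] [Algebra k K] (f : specOver k K ⟶ specOver k L)
    (z : specOver k L ⟶ Z) : imagePt (f ≫ z) = imagePt z := by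
  rw [imagePt_comp]
  exact congrArg z.left (Subsingleton.elim (α := Spec (.of L)) _ _)

variable [LocallyOfFiniteType Z.hom]

variable (Z L) in
theorem jacobsonSpace_tensor : JacobsonSpace (Z ⊗ specOver k L).left :=
  have : LocallyOfFiniteType (pullback.snd Z.hom (specOver k L).hom) := inferInstance
  have : JacobsonSpace (specOver k L).left := inferInstanceAs (JacobsonSpace (Spec (.of L)))
  LocallyOfFiniteType.jacobsonSpace (pullback.snd Z.hom (specOver k L).hom)

theorem exists_imagePt_lift_eq [IsAlgClosed L] {y : (Z ⊗ specOver k L).left} (hy : IsClosed {y}) :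
    ∃ a : specOver k L ⟶ Z, imagePt (lift a (𝟙 _)) = y := by
  let r : (Z ⊗ specOver k L).left ⟶ Spec (.of L) := (snd Z (specOver k L)).left
  have : LocallyOfFiniteType r :=
    inferInstanceAs (LocallyOfFiniteType (pullback.snd Z.hom (specOver k L).hom))
  let p := pointOfClosedPoint r y hy
  have hp : p ≫ r = 𝟙 _ := pointOfClosedPoint_comp r y hy
  let p' : specOver k L ⟶ Z ⊗ specOver k L := Over.homMk p (by
    rw [← Over.w (snd Z (specOver k L))]
    change p ≫ r ≫ _ = _
    rw [reassoc_of% hp])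
  have lift_eq : lift (p' ≫ fst Z _) (𝟙 _) = p' := by
    ext1
    · rw [lift_fst]
    · rw [lift_snd]
      ext1
      exact hp.symm
  exact ⟨p' ≫ fst Z _, by rw [lift_eq]; exact pointOfClosedPoint_apply r y hy _⟩

theorem mem_of_imagePt_lift_mem [IsAlgClosed L] {O : Set (Z ⊗ specOver k L).left} (hO : IsOpen O)
    (h : ∀ a : specOver k L ⟶ Z, imagePt (lift a (𝟙 _)) ∈ O) (y : (Z ⊗ specOver k L).left) :
    y ∈ O := by
  have := jacobsonSpace_tensor Z L
  by_contra hy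
  obtain ⟨y, hy, hyc⟩ := nonempty_inter_closedPoints ⟨y, hy⟩ hO.isClosed_compl.isLocallyClosed
  obtain ⟨a, rfl⟩ := exists_imagePt_lift_eq hyc
  exact hy (h a)

end ImagePt

section Bitranslate

variable {C : Type w} [Category.{v} C] [CartesianMonoidalCategory C] {G S S' : C} [GrpObj G]

/-- The map `(z, t) ↦ a(t) z b(t)`. -/
def bitranslate (a b : S ⟶ G) : G ⊗ S ⟶ G := (snd G S ≫ a) * fst G S * (snd G S ≫ b)

theorem lift_bitranslate (a b : S ⟶ G) (z : S' ⟶ G) (t : S' ⟶ S) :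
    lift z t ≫ bitranslate a b = (t ≫ a) * z * (t ≫ b) := by
  simp [bitranslate, MonObj.comp_mul]

theorem whiskerLeft_comp_bitranslate (j : S' ⟶ S) (a b : S ⟶ G) :
    G ◁ j ≫ bitranslate a b = bitranslate (j ≫ a) (j ≫ b) := by
  simp [bitranslate, MonObj.comp_mul]

theorem isIso_lift_bitranslate (a b : S ⟶ G) : IsIso (lift (bitranslate a b) (snd G S)) := by
  have inv_comp (a b : S ⟶ G) :
      lift (bitranslate a b) (snd G S) ≫ lift (bitranslate a⁻¹ b⁻¹) (snd G S) = 𝟙 _ := by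
    ext1
    · rw [Category.assoc, lift_fst, lift_bitranslate]
      simp [bitranslate, GrpObj.comp_inv, mul_assoc]
    · simp
  exact ⟨⟨lift (bitranslate a⁻¹ b⁻¹) (snd G S), inv_comp a b, by simpa using inv_comp a⁻¹ b⁻¹⟩⟩

end Bitranslate

section Translates

variable {k : Type u} [Field k] {G : Over (Spec (.of k))} [GrpObj G]

theorem bitranslate_left_eq {S : Over (Spec (.of k))} (a b : S ⟶ G) :
    ∃ e : (G ⊗ S).left ⟶ (G ⊗ S).left, IsIso e ∧ (bitranslate a b).left = e ≫ (fst G S).left := by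
  have := isIso_lift_bitranslate a b
  refine ⟨(lift (bitranslate a b) (snd G S)).left,
    inferInstanceAs (IsIso ((Over.forget _).map (lift (bitranslate a b) (snd G S)))), ?_⟩
  rw [← Over.comp_left, lift_fst]

theorem isAffineOpen_preimage_bitranslate {A : Type u} [CommRing A] [Algebra k A]
    (a b : specOver k A ⟶ G) {U : G.left.Opens} (hU : IsAffineOpen U) :
    IsAffineOpen ((bitranslate a b).left ⁻¹ᵁ U) := by
  obtain ⟨e, _, h⟩ := bitranslate_left_eq a b
  have : IsAffineHom (specOver k A).hom :=
    inferInstanceAs (IsAffineHom (Spec.map (CommRingCat.ofHom (algebraMap k A))))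
  have : IsAffineHom (fst G (specOver k A)).left :=
    MorphismProperty.of_isPullback (P := @IsAffineHom)
      (IsPullback.of_hasPullback G.hom (specOver k A).hom).flip this
  rw [h]
  exact hU.preimage _

variable {L : Type u} [Field L] [Algebra k L]

theorem dense_preimage_bitranslate (a b : specOver k L ⟶ G) {U : G.left.Opens}
    (hU : Dense (U : Set G.left)) : Dense ((bitranslate a b).left ⁻¹' U) := by
  obtain ⟨e, _, h⟩ := bitranslate_left_eq a b
  have : UniversallyOpen (specOver k L).hom :=
    inferInstanceAs (UniversallyOpen (Y := Spec (.of k)) _)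
  have : UniversallyOpen (fst G (specOver k L)).left :=
    inferInstanceAs (UniversallyOpen (pullback.fst G.hom (specOver k L).hom))
  have : UniversallyOpen (bitranslate a b).left := by
    rw [h]
    infer_instance
  exact hU.preimage (bitranslate a b).left.isOpenMap

theorem exists_forall_imagePt_mul_mem [LocallyOfFiniteType G.hom] [IsAlgClosed L]
    {U : G.left.Opens} (hU : Dense (U : Set G.left)) {B : Set (specOver k L ⟶ G)} (hB : B.Finite) :
    ∃ h : specOver k L ⟶ G, ∀ b ∈ B, imagePt (h * b) ∈ U := by
  let O (b : specOver k L ⟶ G) : Set (G ⊗ specOver k L).left := (bitranslate 1 b).left ⁻¹' U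
  have isOpen_O (b) : IsOpen (O b) := U.2.preimage (bitranslate 1 b).left.continuous
  have dense_iInter : Dense (⋂ b ∈ B, O b) := by
    rw [← Set.sInter_image]
    refine (hB.image _).dense_sInter ?_ ?_
    · rintro _ ⟨b, -, rfl⟩
      exact isOpen_O b
    · rintro _ ⟨b, -, rfl⟩
      exact dense_preimage_bitranslate _ _ hU
  have : Nonempty (G ⊗ specOver k L).left := ⟨imagePt (lift 1 (𝟙 _))⟩
  have := jacobsonSpace_tensor G L
  obtain ⟨y, hy, hyc⟩ := nonempty_inter_closedPoints dense_iInter.nonempty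
    (hB.isOpen_biInter fun b _ ↦ isOpen_O b).isLocallyClosed
  obtain ⟨h, rfl⟩ := exists_imagePt_lift_eq hyc
  refine ⟨h, fun b hb ↦ ?_⟩
  have mem : (bitranslate 1 b).left (imagePt (lift h (𝟙 _))) ∈ U := Set.mem_iInter₂.mp hy b hb
  rw [← imagePt_comp, lift_bitranslate] at mem
  simpa using mem

end Translates

/-! ### Frobenius orbits -/

theorem StableAffineOpens.exists_mem_iff {Y : Scheme.{u}} {φ : Y ⟶ Y} {N : ℕ} [NeZero N]
    (hφ : End.of φ ^ N = 1)
    (hinf : ∀ U V : Y.Opens, IsAffineOpen U → IsAffineOpen V → IsAffineOpen (U ⊓ V))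
    {V : Y.Opens} (hV : IsAffineOpen V) :
    ∃ W : StableAffineOpens φ, ∀ y, y ∈ W.1 ↔
      ∀ i, End.asHom (X := Y) (End.of φ ^ i) y ∈ V := by
  let f (i : ℕ) : Y ⟶ Y := End.asHom (End.of φ ^ i)
  have isIso_f (i : ℕ) : IsIso (f i) :=
    (isUnit_iff_isIso _).mp ((IsUnit.of_pow_eq_one hφ (NeZero.ne N)).pow i)
  have f_mod (i : ℕ) : f (i % N) = f i :=
    congrArg End.asHom (pow_eq_pow_mod (a := End.of φ) i hφ).symm
  have f_succ (i : ℕ) (y : Y) : f i (φ y) = f (i + 1) y := by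
    rw [← Scheme.Hom.comp_apply]
    exact congrArg (fun g : Y ⟶ Y ↦ g y) (pow_succ (End.of φ) i).symm
  have mem_iInf (y : Y) : y ∈ (⨅ i : Fin N, f i ⁻¹ᵁ V) ↔ ∀ i, f i y ∈ V := by
    rw [← SetLike.mem_coe, TopologicalSpace.Opens.coe_iInf, Set.mem_iInter]
    exact ⟨fun h i ↦ f_mod i ▸ h ⟨i % N, Nat.mod_lt i (Nat.pos_of_neZero N)⟩, fun h i ↦ h i⟩
  have isAffineOpen_iInf : IsAffineOpen (⨅ i : Fin N, f i ⁻¹ᵁ V) := by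
    rw [← Finset.inf'_univ_eq_ciInf]
    exact Finset.inf'_induction _ _ (fun _ h₁ _ h₂ ↦ hinf _ _ h₁ h₂)
      fun i _ ↦ hV.preimage_of_isIso (f i)
  refine ⟨⟨_, isAffineOpen_iInf, ?_⟩, mem_iInf⟩
  ext y
  change φ y ∈ (⨅ i : Fin N, f i ⁻¹ᵁ V) ↔ y ∈ (⨅ i : Fin N, f i ⁻¹ᵁ V)
  simp only [mem_iInf, f_succ]
  refine ⟨fun h i ↦ ?_, fun h i ↦ h (i + 1)⟩
  have f_shift : f (i + (N - 1) + 1) = f i := by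
    rw [← f_mod, add_assoc, Nat.sub_add_cancel NeZero.one_le, Nat.add_mod_right, f_mod]
  exact f_shift ▸ h (i + (N - 1))

section FrobeniusOnPoints

variable {k k' L : Type u} [Field k] [Field k'] [Field L] [Algebra k k'] [Algebra k L]
  [Algebra k' L] [IsScalarTower k k' L] {G Z : Over (Spec (.of k))} {K : IntermediateField k' L}

theorem finite_setOf_isDefinedOver [LocallyOfFiniteType Z.hom] [QuasiCompact Z.hom]
    [Finite K] : {z : specOver k L ⟶ Z | IsDefinedOver K z}.Finite :=
  have := finite_points Z K
  Set.finite_range fun z : specOver k K ⟶ Z ↦ towerMap k K L ≫ z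

theorem IsDefinedOver.mul [MonObj G] {a b : specOver k L ⟶ G} (ha : IsDefinedOver K a)
    (hb : IsDefinedOver K b) : IsDefinedOver K (a * b) := by
  obtain ⟨⟨a, rfl⟩, ⟨b, rfl⟩⟩ := And.intro ha hb
  exact ⟨a * b, MonObj.comp_mul _ _ _⟩

theorem IsDefinedOver.inv [GrpObj G] {a : specOver k L ⟶ G} (ha : IsDefinedOver K a) :
    IsDefinedOver K a⁻¹ := by
  obtain ⟨a, rfl⟩ := ha
  exact ⟨a⁻¹, GrpObj.comp_inv _ _⟩

variable (k k' L) in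
theorem isIso_frob [Fintype k'] [Algebra.IsAlgebraic k' L] : IsIso (frob k k' L) := by
  let e := (FiniteField.frobeniusAlgEquivOfAlgebraic k' L).restrictScalars k
  change IsIso (specMap (e : L →ₐ[k] L))
  refine ⟨specMap (e.symm : L →ₐ[k] L), ?_, ?_⟩
  · rw [← specMap_comp, ← specMap_id, AlgEquiv.comp_symm]
  · rw [← specMap_comp, ← specMap_id, AlgEquiv.symm_comp]

variable [Fintype k']

theorem IsDefinedOver.frob_pow_comp {z : specOver k L ⟶ Z} (hz : IsDefinedOver K z) (i : ℕ) :
    IsDefinedOver K ((End.of (frob k k' L) ^ i : End _) ≫ z) := by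
  obtain ⟨z, rfl⟩ := hz
  refine ⟨(End.of (frob k k' K) ^ i : End _) ≫ z, ?_⟩
  rw [← Category.assoc, ← Category.assoc]
  exact congrArg (· ≫ z) (pow_comp_eq_comp_pow (frob_comp_towerMap K) i).symm

theorem IsDefinedOver.exists_frob_pow_comp_eq [Algebra.IsAlgebraic k' K] {z : specOver k L ⟶ Z}
    (hz : IsDefinedOver K z) (i : ℕ) :
    ∃ w, IsDefinedOver K w ∧ (End.of (frob k k' L) ^ i : End _) ≫ w = z := by
  obtain ⟨z, rfl⟩ := hz
  have isUnit_frob : IsUnit (End.of (frob k k' K)) := (isUnit_iff_isIso _).mpr (isIso_frob k k' K)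
  let F : specOver k K ⟶ specOver k K := End.asHom (End.of (frob k k' K) ^ i)
  have : IsIso F := (isUnit_iff_isIso _).mp (isUnit_frob.pow i)
  have comp_F : (End.of (frob k k' L) ^ i : End _) ≫ towerMap k K L = towerMap k K L ≫ F :=
    pow_comp_eq_comp_pow (frob_comp_towerMap K) i
  refine ⟨towerMap k K L ≫ CategoryTheory.inv F ≫ z, ⟨_, rfl⟩, ?_⟩
  rw [reassoc_of% comp_F, IsIso.hom_inv_id_assoc]

theorem IsDefinedOver.crossedPow_frob [GrpObj G] {g : specOver k L ⟶ G} (hg : IsDefinedOver K g)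
    (i : ℕ) : IsDefinedOver K (crossedPow (frob k k' L) g i) := by
  obtain ⟨g, rfl⟩ := hg
  exact ⟨crossedPow (frob k k' K) g i, comp_crossedPow (frob_comp_towerMap K) g i⟩

variable [Algebra.IsAlgebraic k' L] [LocallyOfFiniteType Z.hom] [QuasiCompact Z.hom]

variable (k') in
theorem finite_range_frob_pow_comp (z : specOver k L ⟶ Z) :
    (Set.range fun i : ℕ ↦ (End.of (frob k k' L) ^ i : End _) ≫ z).Finite := by
  obtain ⟨K, _, hz⟩ := exists_finiteDimensional_isDefinedOver (k' := k') z
  have : Finite K := Module.finite_of_finite k'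
  exact finite_setOf_isDefinedOver.subset (Set.range_subset_iff.mpr hz.frob_pow_comp)

variable (k') in
theorem finite_range_crossedPow_frob [GrpObj G] [LocallyOfFiniteType G.hom] [QuasiCompact G.hom]
    (g : specOver k L ⟶ G) : (Set.range (crossedPow (frob k k' L) g)).Finite := by
  obtain ⟨K, _, hg⟩ := exists_finiteDimensional_isDefinedOver (k' := k') g
  have : Finite K := Module.finite_of_finite k'
  exact finite_setOf_isDefinedOver.subset (Set.range_subset_iff.mpr hg.crossedPow_frob)

end FrobeniusOnPoints

section StableCover

theorem twist_pow_comp_bitranslate {C : Type w} [Category.{v} C] [CartesianMonoidalCategory C]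
    {G S : C} [GrpObj G] (s : S ⟶ S) (g h : S ⟶ G) (i : ℕ) :
    (End.of (twist s g) ^ i : End _) ≫ bitranslate h 1 =
      bitranslate ((End.of s ^ i : End S) ≫ h) (crossedPow s g i)⁻¹ := by
  rw [twist_pow]
  change lift _ _ ≫ _ = _
  rw [lift_bitranslate, bitranslate, MonObj.comp_one, mul_one, GrpObj.comp_inv, mul_assoc,
    Category.assoc]

/-- The points of `G` over `L` whose images under all powers of the twist of the Frobenius by `g`
are translated by `h` into `U`. -/
def stableTranslate {k : Type u} (k' : Type u) {L : Type u} [Field k] [Field k'] [Fintype k']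
    [Field L] [Algebra k k'] [Algebra k L] [Algebra k' L] [IsScalarTower k k' L]
    {G : Over (Spec (.of k))} [GrpObj G] (g h : specOver k L ⟶ G) (U : G.left.Opens) :
    Set (G ⊗ specOver k L).left :=
  {y | ∀ i : ℕ, ((End.of (twist (frob k k' L) g) ^ i : End _) ≫ bitranslate h 1).left y ∈ U}

variable {k k' L : Type u} [Field k] [Field k'] [Fintype k'] [Field L] [Algebra k k'] [Algebra k L]
  [Algebra k' L] [IsScalarTower k k' L] [Algebra.IsAlgebraic k' L] {G : Over (Spec (.of k))}
  [GrpObj G] [LocallyOfFiniteType G.hom] [QuasiCompact G.hom]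

theorem isOpen_stableTranslate (g h : specOver k L ⟶ G) (U : G.left.Opens) :
    IsOpen (stableTranslate k' g h U) := by
  let pairs : Set ((specOver k L ⟶ G) × (specOver k L ⟶ G)) :=
    Set.range fun i : ℕ ↦ ((End.of (frob k k' L) ^ i : End _) ≫ h, (crossedPow (frob k k' L) g i)⁻¹)
  have finite_pairs : pairs.Finite := by
    refine ((finite_range_frob_pow_comp k' h).prod
      (finite_range_crossedPow_frob k' g).inv).subset ?_
    rintro _ ⟨i, rfl⟩
    exact ⟨⟨i, rfl⟩, i, (inv_inv _).symm⟩
  have eq_biInter : stableTranslate k' g h U =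
      ⋂ c ∈ pairs, (bitranslate c.1 c.2).left ⁻¹' U := by
    ext y
    simp [stableTranslate, pairs, twist_pow_comp_bitranslate]
  rw [eq_biInter]
  exact finite_pairs.isOpen_biInter fun c _ ↦ U.2.preimage (bitranslate c.1 c.2).left.continuous

theorem exists_imagePt_lift_mem_stableTranslate [IsAlgClosed L] (g a : specOver k L ⟶ G)
    {U : G.left.Opens} (hU : Dense (U : Set G.left)) :
    ∃ h : specOver k L ⟶ G, imagePt (lift a (𝟙 _)) ∈ stableTranslate k' g h U := by
  obtain ⟨K₁, _, ha⟩ := exists_finiteDimensional_isDefinedOver (k' := k') a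
  obtain ⟨K₂, _, hg⟩ := exists_finiteDimensional_isDefinedOver (k' := k') g
  replace ha := ha.mono (le_sup_left : K₁ ≤ K₁ ⊔ K₂)
  replace hg := hg.mono (le_sup_right : K₂ ≤ K₁ ⊔ K₂)
  have : Finite ↥(K₁ ⊔ K₂) := Module.finite_of_finite k'
  obtain ⟨h, hh⟩ := exists_forall_imagePt_mul_mem hU
    (finite_setOf_isDefinedOver (k := k) (Z := G) (K := K₁ ⊔ K₂))
  refine ⟨h, fun i ↦ ?_⟩
  obtain ⟨w, hw, frob_pow_w⟩ := (ha.mul (hg.crossedPow_frob i).inv).exists_frob_pow_comp_eq i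
  have eq_frob_pow : lift a (𝟙 _) ≫ (End.of (twist (frob k k' L) g) ^ i : End _) ≫
      bitranslate h 1 = (End.of (frob k k' L) ^ i : End _) ≫ (h * w) := by
    rw [twist_pow_comp_bitranslate, lift_bitranslate, Category.id_comp, Category.id_comp,
      MonObj.comp_mul, frob_pow_w, mul_assoc]
  rw [← imagePt_comp, eq_frob_pow, imagePt_comp_left]
  exact hh w hw

variable (k') in
theorem exists_finite_cover_stableTranslate [IsAlgClosed L] (g : specOver k L ⟶ G)
    {U : G.left.Opens} (hU : Dense (U : Set G.left)) :
    ∃ t : Finset (specOver k L ⟶ G), ∀ y, ∃ h ∈ t, y ∈ stableTranslate k' g h U := by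
  have cover : Set.univ ⊆ ⋃ h, stableTranslate k' g h U := fun y _ ↦
    mem_of_imagePt_lift_mem (isOpen_iUnion fun h ↦ isOpen_stableTranslate g h U)
      (fun a ↦ Set.mem_iUnion.mpr (exists_imagePt_lift_mem_stableTranslate g a hU)) y
  have : QuasiCompact (pullback.snd G.hom (specOver k L).hom) := inferInstance
  have : CompactSpace (G ⊗ specOver k L).left :=
    (quasiCompact_iff_compactSpace (Y := Spec (.of L))
      (pullback.snd G.hom (specOver k L).hom)).mp this
  obtain ⟨t, ht⟩ := isCompact_univ.elim_finite_subcover _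
    (fun h ↦ isOpen_stableTranslate (k' := k') g h U) cover
  exact ⟨t, fun y ↦ by simpa using ht (Set.mem_univ y)⟩

end StableCover

/-! ### Objects with a rational point -/

section Sections

variable {k : Type u} [Field k] {G X T S S' : Over (Spec (.of k))} [GrpObj G] [ModObj G X]

theorem IsTorsor.smul_comp [ModObj G T] {π : T ⟶ S} (h : IsTorsor G π) (g : S' ⟶ G) (t : S' ⟶ T) :
    (g • t) ≫ π = t ≫ π := by
  rw [Hom.smul_def, Category.assoc, h.isPullback.w, lift_snd_assoc]

theorem IsTorsor.existsUnique_smul_eq [ModObj G T] {π : T ⟶ S} (h : IsTorsor G π) {a b : S' ⟶ T}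
    (hab : a ≫ π = b ≫ π) : ∃! g : S' ⟶ G, g • b = a :=
  ((isPullback_iff π).mp h.isPullback).2 a b hab

theorem QuotientStack.exists_comp_eq_smul (M : QuotientStack G X S) {s : S' ⟶ S'} {t : S' ⟶ M.T}
    (h : s ≫ t ≫ M.π = t ≫ M.π) : ∃ g : S' ⟶ G, s ≫ t ≫ M.f = g • (t ≫ M.f) := by
  obtain ⟨g, hg, -⟩ := M.torsor.existsUnique_smul_eq (a := s ≫ t) (b := t)
    ((Category.assoc _ _ _).trans h)
  exact ⟨g, by rw [← IsModHom.map_smul, hg, Category.assoc]⟩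

variable [LocallyOfFiniteType G.hom]

theorem QuotientStack.nonempty_ofPoint_iso (M : QuotientStack G X S) {t : S ⟶ M.T}
    (ht : t ≫ M.π = 𝟙 S) : Nonempty (ofPoint (G := G) (t ≫ M.f) ≅ M) := by
  let := translationAction G S
  let a : G ⊗ S ⟶ M.T := fst G S • (snd G S ≫ t)
  have comp_a {Z : Over (Spec (.of k))} (z : Z ⟶ G ⊗ S) :
      z ≫ a = (z ≫ fst G S) • (z ≫ snd G S) ≫ t := by
    rw [ModObj.comp_smul, Category.assoc]
  have a_π : a ≫ M.π = snd G S := by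
    rw [M.torsor.smul_comp, Category.assoc, ht, Category.comp_id]
  have a_f : a ≫ M.f = fst G S • (snd G S ≫ t ≫ M.f) := by
    rw [IsModHom.map_smul, Category.assoc]
  have isModHom_a : IsModHom G a := isModHom_of_points _ fun g z ↦ by
    rw [comp_a, comp_a, translationAction_smul_fst, translationAction_smul_snd, mul_smul]
  obtain ⟨d, hd, -⟩ := M.torsor.existsUnique_smul_eq (a := 𝟙 M.T) (b := M.π ≫ t)
    (by rw [Category.assoc, ht, Category.id_comp, Category.comp_id])
  let b : M.T ⟶ G ⊗ S := lift d M.π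
  have b_a : b ≫ a = 𝟙 _ := by rw [comp_a, lift_fst, lift_snd, hd]
  have a_d : a ≫ d = fst G S := by
    refine (M.torsor.existsUnique_smul_eq (a := a) (b := snd G S ≫ t) ?_).unique ?_ rfl
    · rw [a_π, Category.assoc, ht, Category.comp_id]
    · rw [← a_π, Category.assoc, ← ModObj.comp_smul, hd, Category.comp_id]
  have a_b : a ≫ b = 𝟙 _ := by rw [comp_lift, a_d, a_π, lift_fst_snd]
  have isModHom_b : IsModHom G b := isModHom_of_points _ fun g z ↦ by
    have : Mono a := mono_of_mono_fac a_b
    rw [← cancel_mono a, IsModHom.map_smul a, Category.assoc, Category.assoc, b_a,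
      Category.comp_id, Category.comp_id]
  exact ⟨{
    hom := ⟨a, isModHom_a, a_π, a_f⟩
    inv := ⟨b, isModHom_b, lift_snd _ _, by
      change b ≫ (fst G S • (snd G S ≫ t ≫ M.f)) = M.f
      rw [← a_f, reassoc_of% b_a]⟩
    hom_inv_id := Hom.ext a_b
    inv_hom_id := Hom.ext b_a }⟩

theorem QuotientStack.nonempty_ofPoint_iso_iff {M : QuotientStack G X S} {x : S ⟶ X} :
    Nonempty (ofPoint (G := G) x ≅ M) ↔ ∃ t : S ⟶ M.T, t ≫ M.π = 𝟙 S ∧ t ≫ M.f = x := by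
  refine ⟨fun ⟨e⟩ ↦ ?_, ?_⟩
  · let a : G ⊗ S ⟶ M.T := e.hom.hom
    have a_π : a ≫ M.π = snd G S := e.hom.hom_π
    have a_f : a ≫ M.f = fst G S • (snd G S ≫ x) := e.hom.hom_f
    refine ⟨lift 1 (𝟙 S) ≫ a, ?_, ?_⟩
    · rw [Category.assoc, a_π, lift_snd]
    · rw [Category.assoc, a_f, ModObj.comp_smul, lift_fst, lift_snd_assoc, one_smul,
        Category.id_comp]
  · rintro ⟨t, ht, rfl⟩
    exact M.nonempty_ofPoint_iso ht

theorem QuotientStack.nonempty_ofPoint_iso_baseChange_iff {M : QuotientStack G X S} {s : S' ⟶ S}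
    {x : S' ⟶ X} : Nonempty (ofPoint (G := G) x ≅ M.baseChange s) ↔
      ∃ t : S' ⟶ M.T, t ≫ M.π = s ∧ t ≫ M.f = x := by
  refine nonempty_ofPoint_iso_iff.trans ⟨?_, ?_⟩
  · rintro ⟨(t : S' ⟶ pullback M.π s), t_π, t_f⟩
    replace t_π : t ≫ pullback.snd M.π s = 𝟙 S' := t_π
    replace t_f : t ≫ pullback.fst M.π s ≫ M.f = x := t_f
    refine ⟨t ≫ pullback.fst M.π s, ?_, ?_⟩
    · rw [Category.assoc, pullback.condition, reassoc_of% t_π]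
    · rw [Category.assoc, t_f]
  · rintro ⟨t, rfl, rfl⟩
    exact ⟨pullback.lift t (𝟙 S') (Category.id_comp _).symm, pullback.lift_snd _ _ _,
      pullback.lift_fst_assoc _ _ _ _⟩

end Sections

section Orbits

variable {k L : Type u} [Field k] [Field L] [Algebra k L] {G X : Over (Spec (.of k))} [GrpObj G]
  [ModObj G X]

theorem hasModel_P_iff {k' : Type u} [Field k'] [Algebra k k'] [Algebra k' L]
    [IsScalarTower k k' L] [LocallyOfFiniteType G.hom] {C : Orbits G X L} {x : specOver k L ⟶ X}
    (hx : Quotient.mk _ x = C) :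
    HasModel k' (P C) ↔ ∃ (M : QuotientStack G X (specOver k k')) (t : specOver k L ⟶ M.T),
      t ≫ M.π = towerMap k k' L ∧ t ≫ M.f = x := by
  subst hx
  exact exists_congr fun _ ↦ eq_comm.trans
    (Quotient.eq.trans QuotientStack.nonempty_ofPoint_iso_baseChange_iff)

theorem Orbits.smul_eq_self_iff {σ : Gal(L/k)} {C : Orbits G X L} {x : specOver k L ⟶ X}
    (hx : Quotient.mk _ x = C) :
    σ • C = C ↔ ∃ g : specOver k L ⟶ G, specMap (σ : L →ₐ[k] L) ≫ x = g • x := by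
  subst hx
  refine Quotient.eq.trans ?_
  exact exists_congr fun _ ↦ eq_comm

end Orbits

/-! ### Models of Frobenius-stable orbits -/

section Model

variable {k k' : Type u} [Field k] [Field k'] [Algebra k k']

theorem exists_quotient_over {K : Type u} [Field K] [Algebra k K] [Algebra k' K]
    [IsScalarTower k k' K] [FiniteDimensional k' K] {F : K →ₐ[k'] K}
    (hF : orderOf F = Module.finrank k' K) {Y : Over (Spec (.of k))} {φ : Y ⟶ Y}
    {r : Y ⟶ specOver k K} (hr : φ ≫ r = r ≫ specMap (F.restrictScalars k))
    (hφ : End.of φ ^ Module.finrank k' K = 1)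
    (hinf : ∀ U V : Y.left.Opens, IsAffineOpen U → IsAffineOpen V → IsAffineOpen (U ⊓ V))
    (hcov : ∀ y, ∃ V : StableAffineOpens φ.left, y ∈ V.1) :
    ∃ (T : Over (Spec (.of k))) (π : T ⟶ specOver k k') (p : Y ⟶ T), φ ≫ p = p ∧
      IsPullback p r π (towerMap k k' K) := by
  have pow_left : End.of φ.left ^ Module.finrank k' K = 1 := by
    have := congrArg ((Over.forget _).mapEnd Y) hφ
    rwa [map_pow, map_one] at this
  obtain ⟨T, π, p, hp, h⟩ :=
    exists_quotient φ.left hF (r := r.left) (congrArg (·.left) hr) pow_left hinf hcov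
  let p' : Y ⟶ Over.mk (π ≫ (specOver k k').hom) := Over.homMk p (by
    change p ≫ π ≫ _ = _
    rw [reassoc_of% h.w, ← Over.w r, ← Over.w (towerMap k k' K)]
    rfl)
  let π' : Over.mk (π ≫ (specOver k k').hom) ⟶ specOver k k' := Over.homMk π
  have comm : p' ≫ π' = r ≫ towerMap k k' K := by
    ext1
    exact h.w
  refine ⟨_, π', p', ?_, IsPullback.of_map (Over.forget _) comm h⟩
  ext1
  exact hp

variable {L : Type u} [Field L] [Algebra k L] [Algebra k' L] [IsScalarTower k k' L]
  {G X : Over (Spec (.of k))}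

theorem surjective_whiskerLeft_towerMap (G : Over (Spec (.of k))) (K : IntermediateField k' L) :
    Function.Surjective (G ◁ towerMap k K L).left := by
  have h := (isPullback_whiskerLeft_snd (G := G) (towerMap k K L)).map (Over.forget _)
  have surjective_towerMap : Surjective (towerMap k K L).left :=
    ⟨Function.surjective_to_subsingleton (α := Spec (.of L)) (β := Spec (.of K)) _⟩
  exact (MorphismProperty.of_isPullback (P := @Surjective) h.flip surjective_towerMap).surj

variable [Fintype k']

theorem exists_finiteDimensional_forall_isDefinedOver [IsAlgClosed L] [Algebra.IsAlgebraic k' L]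
    [LocallyOfFiniteType G.hom] {n : ℕ} [NeZero n] {x : specOver k L ⟶ X}
    (hx : (End.of (frob k k' L) ^ n : End _) ≫ x = x) (g : specOver k L ⟶ G)
    (t : Finset (specOver k L ⟶ G)) :
    ∃ K : IntermediateField k' L, FiniteDimensional k' K ∧ n ∣ Module.finrank k' K ∧
      IsDefinedOver K x ∧ IsDefinedOver K g ∧ ∀ h ∈ t, IsDefinedOver K h := by
  obtain ⟨K₁, _, hx⟩ := exists_finiteDimensional_isDefinedOver_of_frob_pow (NeZero.pos n) hx
  obtain ⟨K₂, _, hg⟩ := exists_finiteDimensional_isDefinedOver (k' := k') g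
  choose K₃ finiteDimensional_K₃ ht using
    fun h : t ↦ exists_finiteDimensional_isDefinedOver (k' := k') h.1
  obtain ⟨K₄, _, finrank_K₄⟩ := exists_intermediateField_finrank_eq k' L n
  let K := (K₁ ⊔ K₂) ⊔ ((⨆ h, K₃ h) ⊔ K₄)
  have finiteDimensional_K : FiniteDimensional k' K := inferInstance
  have K₄_le : K₄ ≤ K := le_sup_right.trans le_sup_right
  exact ⟨K, finiteDimensional_K, finrank_K₄ ▸ IntermediateField.finrank_dvd_of_le_right K₄_le,
    hx.mono (le_sup_left.trans le_sup_left), hg.mono (le_sup_right.trans le_sup_left),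
    fun h hh ↦ (ht ⟨h, hh⟩).mono ((le_iSup K₃ _).trans (le_sup_left.trans le_sup_right))⟩

variable [GrpObj G] [ModObj G X]

theorem twist_frob_pow_finrank {K : Type u} [Field K] [Algebra k K] [Algebra k' K]
    [IsScalarTower k k' K] [FiniteDimensional k' K] {g : specOver k K ⟶ G}
    (hg : crossedPow (frob k k' K) g (Module.finrank k' K) = 1) :
    End.of (twist (frob k k' K) g) ^ Module.finrank k' K = 1 := by
  have : Finite K := Module.finite_of_finite k'
  have frobenius_pow : FiniteField.frobeniusAlgHom k' K ^ Module.finrank k' K = 1 := by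
    rw [← FiniteField.orderOf_frobeniusAlgHom k' K, pow_orderOf_eq_one]
  have frob_pow : (End.of (frob k k' K) ^ Module.finrank k' K : End _) = 𝟙 (specOver k K) := by
    rw [← specMap_pow, ← specMap_id]
    congr 1
    ext a
    have := DFunLike.congr_fun frobenius_pow a
    rwa [AlgHom.coe_pow] at this ⊢
  rw [twist_pow, hg, frob_pow]
  change lift _ _ = 𝟙 _
  simp

theorem exists_mem_stableAffineOpens_twist {K : IntermediateField k' L} [FiniteDimensional k' K]
    {g : specOver k K ⟶ G} (hg : crossedPow (frob k k' K) g (Module.finrank k' K) = 1)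
    {U : G.left.Opens} (hU : IsAffineOpen U) {t : Set (specOver k L ⟶ G)}
    (ht : ∀ h ∈ t, IsDefinedOver K h)
    (hcov : ∀ y, ∃ h ∈ t, y ∈ stableTranslate k' (towerMap k K L ≫ g) h U)
    (y : (G ⊗ specOver k K).left) :
    ∃ V : StableAffineOpens (twist (frob k k' K) g).left, y ∈ V.1 := by
  let φ := twist (frob k k' K) g
  have : NeZero (Module.finrank k' K) := ⟨Module.finrank_pos.ne'⟩
  have left_pow (i : ℕ) : (End.of φ ^ i : End _).left = End.of φ.left ^ i :=
    map_pow ((Over.forget _).mapEnd _) (End.of φ) i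
  have pow_left : End.of φ.left ^ Module.finrank k' K = 1 := by
    rw [← left_pow, twist_frob_pow_finrank hg]
    rfl
  obtain ⟨y, rfl⟩ := surjective_whiskerLeft_towerMap G K y
  obtain ⟨h, h_mem, hy⟩ := hcov y
  obtain ⟨h, rfl⟩ := ht h h_mem
  obtain ⟨V, mem_V⟩ := StableAffineOpens.exists_mem_iff pow_left (fun _ _ ↦ isAffineOpen_inf G K)
    (isAffineOpen_preimage_bitranslate h 1 hU)
  refine ⟨V, (mem_V _).mpr fun i ↦ ?_⟩
  have comm : (End.of (twist (frob k k' L) (towerMap k K L ≫ g)) ^ i : End _) ≫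
      bitranslate (towerMap k K L ≫ h) 1 =
      G ◁ towerMap k K L ≫ (End.of φ ^ i : End _) ≫ bitranslate h 1 := by
    rw [← MonObj.comp_one (towerMap k K L), ← whiskerLeft_comp_bitranslate,
      reassoc_of% pow_comp_eq_comp_pow (whiskerLeft_comp_twist (frob_comp_towerMap K) g) i]
  have mem := hy i
  rw [comm] at mem
  rwa [← left_pow]

theorem exists_model_of_crossedPow_eq_one [LocallyOfFiniteType G.hom] {K : Type u} [Field K]
    [Algebra k K] [Algebra k' K] [IsScalarTower k k' K] [FiniteDimensional k' K]
    {x : specOver k K ⟶ X} {g : specOver k K ⟶ G} (hx : frob k k' K ≫ x = g • x)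
    (hg : crossedPow (frob k k' K) g (Module.finrank k' K) = 1)
    (hcov : ∀ y, ∃ V : StableAffineOpens (twist (frob k k' K) g).left, y ∈ V.1) :
    ∃ (M : QuotientStack G X (specOver k k')) (t : specOver k K ⟶ M.T),
      t ≫ M.π = towerMap k k' K ∧ t ≫ M.f = x := by
  have : Finite K := Module.finite_of_finite k'
  have orderOf_frobenius := FiniteField.orderOf_frobeniusAlgHom k' K
  obtain ⟨T, π, p, hp, h⟩ := exists_quotient_over orderOf_frobenius
    (twist_comp_snd (frob k k' K) g) (twist_frob_pow_finrank hg)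
    (fun _ _ ↦ isAffineOpen_inf G K) hcov
  let N := QuotientStack.ofPoint (G := G) x
  let φ : N.T ⟶ N.T := twist (frob k k' K) g
  have isModHom_φ : IsModHom G φ := isModHom_twist _ _
  have φ_f : φ ≫ N.f = N.f := twist_comp_fst_smul hx
  obtain ⟨M, q, -, hq, q_f⟩ :=
    N.exists_descent orderOf_frobenius (twist_comp_snd _ _) φ_f hp h
  obtain ⟨e, e_π, e_f⟩ := QuotientStack.nonempty_ofPoint_iso_iff.mp ⟨Iso.refl N⟩
  refine ⟨M, e ≫ q, ?_, ?_⟩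
  · rw [Category.assoc, hq.w, reassoc_of% e_π]
  · rw [Category.assoc, q_f, e_f]

theorem exists_model_of_frob_comp_eq_smul [IsAlgClosed L] [Algebra.IsAlgebraic k' L]
    [LocallyOfFiniteType G.hom] [QuasiCompact G.hom] {x : specOver k L ⟶ X} {g : specOver k L ⟶ G}
    (hx : frob k k' L ≫ x = g • x) :
    ∃ (M : QuotientStack G X (specOver k k')) (t : specOver k L ⟶ M.T),
      t ≫ M.π = towerMap k k' L ∧ t ≫ M.f = x := by
  have := epi_specMap ((FiniteField.frobeniusAlgHom k' L).restrictScalars k)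
  obtain ⟨n, hn, crossedPow_eq_one⟩ := exists_crossedPow_eq_one (frob k k' L) g
    (finite_range_crossedPow_frob k' g)
  have : NeZero n := ⟨hn.ne'⟩
  have frob_pow_x : (End.of (frob k k' L) ^ n : End _) ≫ x = x := by
    rw [pow_comp_eq_crossedPow_smul hx, crossedPow_eq_one n dvd_rfl, one_smul]
  have : IsLocallyNoetherian G.left := LocallyOfFiniteType.isLocallyNoetherian G.hom
  have : CompactSpace G.left := (quasiCompact_iff_compactSpace (f := G.hom)).mp ‹_›
  have : IsNoetherian G.left := {}
  obtain ⟨U, hU, dense_U⟩ := exists_dense_isAffineOpen G.left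
  obtain ⟨s, cover⟩ := exists_finite_cover_stableTranslate k' g dense_U
  obtain ⟨K, _, n_dvd, ⟨x, rfl⟩, ⟨g, rfl⟩, hs⟩ :=
    exists_finiteDimensional_forall_isDefinedOver frob_pow_x g s
  have := epi_specMap ((IsScalarTower.toAlgHom k' K L).restrictScalars k)
  have : Epi (towerMap k K L) := this
  have hx : frob k k' K ≫ x = g • x := by
    rw [← cancel_epi (towerMap k K L), ModObj.comp_smul, ← hx, reassoc_of% frob_comp_towerMap K]
  have hg : crossedPow (frob k k' K) g (Module.finrank k' K) = 1 := by
    rw [← cancel_epi (towerMap k K L), comp_crossedPow (frob_comp_towerMap K),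
      crossedPow_eq_one _ n_dvd, MonObj.comp_one]
  obtain ⟨M, t, t_π, t_f⟩ := exists_model_of_crossedPow_eq_one hx hg
    (exists_mem_stableAffineOpens_twist hg hU hs cover)
  refine ⟨M, towerMap k K L ≫ t, ?_, ?_⟩
  · rw [Category.assoc, t_π, ← specMap_comp]
    rfl
  · rw [Category.assoc, t_f]

end Model

end QuotStack

end

theorem mainTheorem5 {k : Type u} [Field k] [Finite k]
    (G : Over (Spec (.of k))) [GrpObj G] [LocallyOfFiniteType G.hom] [QuasiCompact G.hom]
    (X : Over (Spec (.of k))) [ModObj G X]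
    (kbar : Type u) [Field kbar] [Algebra k kbar] [IsAlgClosure k kbar]
    (C : QuotStack.Orbits G X kbar)
    (k' : Type u) [Field k'] [Algebra k k'] [FiniteDimensional k k']
    [Algebra k' kbar] [IsScalarTower k k' kbar] :
    QuotStack.HasModel k' (QuotStack.P C) ↔ ∀ σ : Gal(kbar/k'), σ.restrictScalars k • C = C := by
  obtain ⟨x, hx⟩ := Quotient.exists_rep C
  rw [QuotStack.hasModel_P_iff hx]
  constructor
  · rintro ⟨M, t, t_π, rfl⟩ σ
    refine (QuotStack.Orbits.smul_eq_self_iff hx).mpr (M.exists_comp_eq_smul ?_)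
    rw [t_π, QuotStack.towerMap, ← QuotStack.specMap_comp]
    congr 1
    ext a
    exact σ.commutes a
  · intro hC
    have : IsAlgClosed kbar := IsAlgClosure.isAlgClosed k
    have : Algebra.IsAlgebraic k kbar := IsAlgClosure.isAlgebraic
    have : Algebra.IsAlgebraic k' kbar := .tower_top (K := k) k'
    have : Finite k' := Module.finite_of_finite k
    have := Fintype.ofFinite k'
    obtain ⟨g, hg⟩ := (QuotStack.Orbits.smul_eq_self_iff hx).mp
      (hC (FiniteField.frobeniusAlgEquivOfAlgebraic k' kbar))
    exact QuotStack.exists_model_of_frob_comp_eq_smul hg
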